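/- Let $s\in\mathbb{N}$, $s\ge 1$, put $\mathbb{Z}^3_*=\mathbb{Z}^3\setminus\{0\}$, and let real numbers $\hat V_k$ be given with $\hat V_{-k}=\hat V_k\geq 0$ for all $k\in\mathbb{Z}^3_*$. For $k_F>0$ and $k\in\mathbb{Z}^3_*$ let $$L_k=\{p\in\mathbb{Z}^3 : |p-k|\le k_F<|p|\},\qquad \lambda_{k,p}=\tfrac12\left(|p|^2-|p-k|^2\right)\quad (p\in L_k),$$ where $|\cdot|$ is the Euclidean norm. Let $(e_p)_{p\in L_k}$ be the standard orthonormal basis of the (finite-dimensional, real) Hilbert space $\ell^2(L_k)$, and define operators on $\ell^2(L_k)$ by $$h_ke_p=\lambda_{k,p}e_p,\qquad P_k=\langle v_k,\cdot\rangle v_k,\qquad v_k=\sqrt{\frac{s\hat V_kk_F^{-1}}{2(2\pi)^3}}\sum_{p\in L_k}e_p,$$ $$K_k=-\tfrac12\log\left(h_k^{-1/2}\left(h_k^{1/2}(h_k+2P_k)h_k^{1/2}\right)^{1/2}h_k^{-1/2}\right),$$ and, for $t\in[0,1]$, $$A_k(t)=\tfrac12\left(e^{tK_k}(h_k+2P_k)e^{tK_k}+e^{-tK_k}h_ke^{-tK_k}\right)-h_k,$$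 $$B_k(t)=\tfrac12\left(e^{tK_k}(h_k+2P_k)e^{tK_k}-e^{-tK_k}h_ke^{-tK_k}\right).$$ Write $\{S,T\}=ST+TS$, $\|T\|_{\mathrm{HS}}=\left(\sum_{p,q\in L_k}|\langle e_p,Te_q\rangle|^2\right)^{1/2}$ and $F(x)=\log(1+x)-x$. (1) For all $k_F>0$ and $k\in\mathbb{Z}^3_*$ the integral below converges absolutely and $$\mathrm{tr}\left(e^{-K_k}h_ke^{-K_k}-h_k-P_k\right)=\frac1\pi\int_0^\infty F\left(\frac{s\hat V_kk_F^{-1}}{(2\pi)^3}\sum_{p\in L_k}\frac{\lambda_{k,p}}{\lambda_{k,p}^2+t^2}\right)dt.$$ (2) There are constants $C>0$ and $\kappa>0$, depending only on $s$, such that for all $k_F\ge\kappa$, all $(\hat V_k)$ as above and all $k\in\mathbb{Z}^3_*$, $$\|K_k\|_{\mathrm{HS}}\le C\hat V_k\min\{1,k_F^2|k|^{-2}\},$$ and for all $p,q\in L_k$ and $t\in[0,1]$ (with $t\mapsto\langle e_p,B_k(t)e_q\rangle$ integrable on $[0,1]$) $$|\langle e_p,K_ke_q\rangle|\le C\frac{\hat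 V_kk_F^{-1}}{\lambda_{k,p}+\lambda_{k,q}},$$ $$\left|\langle e_p,(-K_k)e_q\rangle-\frac{s\hat V_kk_F^{-1}}{2(2\pi)^3}\frac1{\lambda_{k,p}+\lambda_{k,q}}\right|\le C\frac{\hat V_k^2k_F^{-1}}{\lambda_{k,p}+\lambda_{k,q}},$$ $$|\langle e_p,A_k(t)e_q\rangle|,\ |\langle e_p,B_k(t)e_q\rangle|\le C(1+\hat V_k^2)\hat V_kk_F^{-1},$$ $$\left|\left\langle e_p,\left(\int_0^1B_k(t)\,dt\right)e_q\right\rangle-\frac{s\hat V_kk_F^{-1}}{4(2\pi)^3}\right|\le C(1+\hat V_k)\hat V_k^2k_F^{-1},$$ $$|\langle e_p,\{K_k,B_k(t)\}e_q\rangle|\le C(1+\hat V_k^2)\hat V_k^2k_F^{-1}.$$ -/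

import Mathlib

namespace FermiGas

noncomputable section

/-- The Euclidean length `|p|` of a lattice point `p ∈ ℤ³`. -/
def latticeNorm (p : Fin 3 → ℤ) : ℝ := √(∑ i, (p i : ℝ) ^ 2)

/-- The lune `L_k = {p ∈ ℤ³ | |p - k| ≤ k_F < |p|}`. -/
def lune (kF : ℝ) (k : Fin 3 → ℤ) : Set (Fin 3 → ℤ) :=
  {p | latticeNorm (p - k) ≤ kF ∧ kF < latticeNorm p}

theorem abs_coord_le_latticeNorm (p : Fin 3 → ℤ) (i : Fin 3) :
    |(p i : ℝ)| ≤ latticeNorm p := by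
  apply Real.abs_le_sqrt
  exact Finset.single_le_sum (f := fun j => (p j : ℝ) ^ 2)
    (fun j _ => sq_nonneg _) (Finset.mem_univ i)

theorem lune_finite (kF : ℝ) (k : Fin 3 → ℤ) : (lune kF k).Finite := by
  refine (Set.finite_Icc (fun i => k i - ⌈kF⌉) (fun i => k i + ⌈kF⌉)).subset ?_
  rintro p ⟨hp, -⟩
  have key : ∀ i, |p i - k i| ≤ ⌈kF⌉ := by
    intro i
    have h1 : |((p - k) i : ℝ)| ≤ kF := (abs_coord_le_latticeNorm (p - k) i).trans hp
    have h2 : ((|p i - k i| : ℤ) : ℝ) ≤ (⌈kF⌉ : ℝ) := by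
      push_cast
      have h3 := h1.trans (Int.le_ceil kF)
      simpa using h3
    exact_mod_cast h2
  constructor
  · intro i
    have := (abs_le.mp (key i)).1
    change k i - ⌈kF⌉ ≤ p i
    linarith
  · intro i
    have := (abs_le.mp (key i)).2
    change p i ≤ k i + ⌈kF⌉
    linarith

instance instFintypeLune (kF : ℝ) (k : Fin 3 → ℤ) : Fintype (lune kF k) :=
  (lune_finite kF k).fintype

/-- `λ_{k,p} = (|p|² - |p - k|²) / 2`. -/
def lam (k p : Fin 3 → ℤ) : ℝ := (latticeNorm p ^ 2 - latticeNorm (p - k) ^ 2) / 2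

/-- Linear operators on the finite-dimensional real Hilbert space `ℓ²(L_k)`, represented by their
matrices in the standard orthonormal basis `(e_p)`, `p ∈ L_k`: the entry `T p q` is
`⟨e_p, T e_q⟩`. -/
abbrev Op (kF : ℝ) (k : Fin 3 → ℤ) : Type := Matrix (lune kF k) (lune kF k) ℝ

/-- Real powers of a positive definite operator, by functional calculus. -/
def opPow {kF : ℝ} {k : Fin 3 → ℤ} (T : Op kF k) (r : ℝ) : Op kF k :=
  cfc (fun x : ℝ => x ^ r) T

/-- The logarithm of a positive definite operator, by functional calculus. -/
def opLog {kF : ℝ} {k : Fin 3 → ℤ} (T : Op kF k) : Op kF k := cfc Real.log T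

/-- The Hilbert–Schmidt norm. -/
def hsNorm {kF : ℝ} {k : Fin 3 → ℤ} (T : Op kF k) : ℝ := √(∑ p, ∑ q, |T p q| ^ 2)

/-- The diagonal operator `h_k e_p = λ_{k,p} e_p`. -/
def h (kF : ℝ) (k : Fin 3 → ℤ) : Op kF k := Matrix.diagonal fun p => lam k p

/-- The vector `v_k = √(s V̂_k k_F⁻¹ / (2 (2π)³)) ∑_{p ∈ L_k} e_p`, in coordinates. -/
def v (s : ℕ) (V : (Fin 3 → ℤ) → ℝ) (kF : ℝ) (k : Fin 3 → ℤ) : lune kF k → ℝ :=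
  fun _ => √(s * V k * kF⁻¹ / (2 * (2 * Real.pi) ^ 3))

/-- The rank one operator `P_k = ⟨v_k, ·⟩ v_k`. -/
def P (s : ℕ) (V : (Fin 3 → ℤ) → ℝ) (kF : ℝ) (k : Fin 3 → ℤ) : Op kF k :=
  Matrix.vecMulVec (v s V kF k) (v s V kF k)

/-- `K_k = -1/2 log (h_k^{-1/2} (h_k^{1/2} (h_k + 2 P_k) h_k^{1/2})^{1/2} h_k^{-1/2})`. -/
def K (s : ℕ) (V : (Fin 3 → ℤ) → ℝ) (kF : ℝ) (k : Fin 3 → ℤ) : Op kF k :=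
  (-(1 / 2) : ℝ) • opLog
    (opPow (h kF k) (-(1 / 2)) *
      opPow (opPow (h kF k) (1 / 2) * (h kF k + (2 : ℝ) • P s V kF k) * opPow (h kF k) (1 / 2))
        (1 / 2) *
      opPow (h kF k) (-(1 / 2)))

/-- The operator exponential `e^{t K_k}`. -/
def expK (s : ℕ) (V : (Fin 3 → ℤ) → ℝ) (kF : ℝ) (k : Fin 3 → ℤ) (t : ℝ) : Op kF k :=
  NormedSpace.exp (t • K s V kF k)

/-- `A_k(t) = 1/2 (e^{tK_k} (h_k + 2 P_k) e^{tK_k} + e^{-tK_k} h_k e^{-tK_k}) - h_k`. -/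
def A (s : ℕ) (V : (Fin 3 → ℤ) → ℝ) (kF : ℝ) (k : Fin 3 → ℤ) (t : ℝ) : Op kF k :=
  (1 / 2 : ℝ) •
    (expK s V kF k t * (h kF k + (2 : ℝ) • P s V kF k) * expK s V kF k t
      + expK s V kF k (-t) * h kF k * expK s V kF k (-t)) - h kF k

/-- `B_k(t) = 1/2 (e^{tK_k} (h_k + 2 P_k) e^{tK_k} - e^{-tK_k} h_k e^{-tK_k})`. -/
def B (s : ℕ) (V : (Fin 3 → ℤ) → ℝ) (kF : ℝ) (k : Fin 3 → ℤ) (t : ℝ) : Op kF k :=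
  (1 / 2 : ℝ) •
    (expK s V kF k t * (h kF k + (2 : ℝ) • P s V kF k) * expK s V kF k t
      - expK s V kF k (-t) * h kF k * expK s V kF k (-t))

/-- The operator `∫₀¹ B_k(t) dt`; integrals of matrices are taken entrywise. -/
def intB (s : ℕ) (V : (Fin 3 → ℤ) → ℝ) (kF : ℝ) (k : Fin 3 → ℤ) : Op kF k :=
  Matrix.of fun p q => ∫ t in (0 : ℝ)..1, B s V kF k t p q

/-- The anticommutator `{S, T} = S T + T S`. -/
def anticomm {kF : ℝ} {k : Fin 3 → ℤ} (S T : Op kF k) : Op kF k := S * T + T * S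

/-- `F(x) = log (1 + x) - x`. -/
def F (x : ℝ) : ℝ := Real.log (1 + x) - x

/-- The argument `(s V̂_k k_F⁻¹ / (2π)³) ∑_{p ∈ L_k} λ_{k,p} / (λ_{k,p}² + t²)` of `F`. -/
def bosonicArg (s : ℕ) (V : (Fin 3 → ℤ) → ℝ) (kF : ℝ) (k : Fin 3 → ℤ) (t : ℝ) : ℝ :=
  s * V k * kF⁻¹ / (2 * Real.pi) ^ 3 * ∑ p : lune kF k, lam k p / (lam k p ^ 2 + t ^ 2)

end

end FermiGas

/-! Write b for the common squared entry of v_k (`coupling`), E = (h^{1/2}(h + 2P)h^{1/2})^{1/2}, N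
= h^{-1/2} E h^{-1/2} and J = log N, so that K = -J/2. Everything rests on E² = h² + 2b w wᵀ, w_p =
λ_p^{1/2}, being a rank-one perturbation of a diagonal matrix.

Trace formula: tr(e^{-K} h e^{-K}) = tr(hN) = tr E = ∑ √m_i, where the m_i are the eigenvalues of
E². The matrix determinant lemma (`prod_eigenvalues_rankOnePert`) gives ∏(m_i + t²) = ∏(λ_p² + t²) ·
(1 + 2 g(t)) with g = `resolventForm`. Taking logarithms and integrating with ∫₀^∞ log((a² + t²)/(b²
+ t²)) dt = π(a - b) turns this product into the integral of F.

Entry bounds come from entrywise positivity. By Sherman–Morrison the resolvent of E² lies entrywise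
below that of h²; integrating in t gives E⁻¹ ≤ h⁻¹, so W = 1 - N⁻¹ has nonnegative entries. A
Perron–Frobenius argument puts the spectral radius of W below 1, and the series of J = -log(1 - W)
shows that J, hence also Z = N - 1 = e^J - 1, has nonnegative entries. Squaring E = h + h^{1/2} Z
h^{1/2} gives the Riccati equation Z_pq(λ_p + λ_q) + ∑ λ_r Z_pr Z_rq = 2b. Positivity yields Z_pq ≤
2b/(λ_p + λ_q), and inserting this in the quadratic term yields a matching lower bound. The
inequalities 0 ≤ J ≤ Z and Z - J ≤ Z²/2 carry the bounds to K; comparing power series carries them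
to e^{tK}, hence to A and B. All errors are governed by g = b ∑ λ_r⁻¹ (`operator_bounds`).

It remains to show ∑ λ⁻¹ ≤ C k_F min{1, k_F²/|k|²} (`sum_inv_lam_le`). For |k| ≤ 4k_F the lune is
cut dyadically in λ, and each piece is counted by comparing unit cubes with the volume of a
cylindrical shell around the axis k. Counting disjoint translates of the piece along k keeps the
bound sharp for short k. For |k| > 4k_F every λ is at least |k|²/4 and counting the ball suffices.
-/

namespace FermiGas

/-! ### Functional calculus in an orthonormal eigenbasis -/

section Spectral

variable {n : Type*} [Fintype n] [DecidableEq n]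

/-- The matrix `U diag(d) Uᵀ`. -/
def conjDiag (U : Matrix n n ℝ) (d : n → ℝ) : Matrix n n ℝ :=
  U * Matrix.diagonal d * U.transpose

theorem conjDiag_apply (U : Matrix n n ℝ) (d : n → ℝ) (p q : n) :
    conjDiag U d p q = ∑ i, U p i * U q i * d i := by
  rw [conjDiag, Matrix.mul_apply]
  simp only [Matrix.mul_diagonal, Matrix.transpose_apply]
  exact Finset.sum_congr rfl fun i _ => by ring

theorem conjDiag_one_left (d : n → ℝ) : conjDiag 1 d = Matrix.diagonal d := by
  simp [conjDiag]

theorem conjDiag_mul {U : Matrix n n ℝ} (hU : U.transpose * U = 1) (d e : n → ℝ) :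
    conjDiag U d * conjDiag U e = conjDiag U (d * e) := by
  calc conjDiag U d * conjDiag U e
      = U * Matrix.diagonal d * (U.transpose * U) * Matrix.diagonal e * U.transpose := by
        simp only [conjDiag, Matrix.mul_assoc]
    _ = conjDiag U (d * e) := by
        rw [hU, Matrix.mul_one, Matrix.mul_assoc U, Matrix.diagonal_mul_diagonal]; rfl

theorem conjDiag_const {U : Matrix n n ℝ} (hU : U.transpose * U = 1) (c : ℝ) :
    conjDiag U (fun _ => c) = c • (1 : Matrix n n ℝ) := by
  have h1 : Matrix.diagonal (fun _ : n => c) = c • (1 : Matrix n n ℝ) := by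
    rw [Matrix.smul_one_eq_diagonal]
  rw [conjDiag, h1, Matrix.mul_smul, Matrix.smul_mul, Matrix.mul_one, mul_eq_one_comm.mp hU]

theorem conjDiag_add (U : Matrix n n ℝ) (d e : n → ℝ) :
    conjDiag U d + conjDiag U e = conjDiag U (d + e) := by
  ext p q
  simp only [Matrix.add_apply, conjDiag_apply, ← Finset.sum_add_distrib, Pi.add_apply, mul_add]

theorem conjDiag_smul (U : Matrix n n ℝ) (c : ℝ) (d : n → ℝ) :
    c • conjDiag U d = conjDiag U (c • d) := by
  ext p q
  simp only [Matrix.smul_apply, conjDiag_apply, Pi.smul_apply, smul_eq_mul, Finset.mul_sum]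
  exact Finset.sum_congr rfl fun i _ => by ring

theorem conjDiag_pow {U : Matrix n n ℝ} (hU : U.transpose * U = 1) (d : n → ℝ) (m : ℕ) :
    conjDiag U d ^ m = conjDiag U (d ^ m) := by
  induction m with
  | zero =>
    rw [pow_zero, pow_zero]
    have := conjDiag_const hU 1
    rw [one_smul] at this
    exact this.symm
  | succ m ih => rw [pow_succ, ih, conjDiag_mul hU, ← pow_succ]

theorem conjDiag_isSymm (U : Matrix n n ℝ) (d : n → ℝ) : (conjDiag U d).IsSymm := by
  ext p q
  simp only [Matrix.transpose_apply, conjDiag_apply]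
  exact Finset.sum_congr rfl fun i _ => by ring

theorem trace_conjDiag {U : Matrix n n ℝ} (hU : U.transpose * U = 1) (d : n → ℝ) :
    (conjDiag U d).trace = ∑ i, d i := by
  rw [conjDiag, Matrix.trace_mul_comm, ← Matrix.mul_assoc, hU, Matrix.one_mul,
    Matrix.trace_diagonal]

theorem det_conjDiag {U : Matrix n n ℝ} (hU : U.transpose * U = 1) (d : n → ℝ) :
    (conjDiag U d).det = ∏ i, d i := by
  rw [conjDiag, Matrix.det_mul_comm, ← Matrix.mul_assoc, hU, Matrix.one_mul,
    Matrix.det_diagonal]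

theorem exp_conjDiag {U : Matrix n n ℝ} (hU : U.transpose * U = 1) (d : n → ℝ) :
    NormedSpace.exp (conjDiag U d) = conjDiag U (fun i => Real.exp (d i)) := by
  have hinv : U⁻¹ = U.transpose := Matrix.inv_eq_left_inv hU
  have hunit : IsUnit U := IsUnit.of_mul_eq_one _ (mul_eq_one_comm.mp hU)
  rw [conjDiag, ← hinv, Matrix.exp_conj U _ hunit, Matrix.exp_diagonal, hinv, conjDiag]
  congr 3
  ext i
  rw [Pi.coe_exp, Real.exp_eq_exp_ℝ]

theorem aeval_conjDiag {U : Matrix n n ℝ} (hU : U.transpose * U = 1) (d : n → ℝ)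
    (P : Polynomial ℝ) :
    Polynomial.aeval (conjDiag U d) P = conjDiag U (fun i => P.eval (d i)) := by
  induction P using Polynomial.induction_on' with
  | add P Q hP hQ =>
    rw [map_add, hP, hQ, conjDiag_add]
    simp only [Polynomial.eval_add]
    rfl
  | monomial m a =>
    rw [Polynomial.aeval_monomial, conjDiag_pow hU, ← Algebra.smul_def, conjDiag_smul]
    simp only [Polynomial.eval_monomial]
    rfl

theorem cfc_conjDiag {U : Matrix n n ℝ} (hU : U.transpose * U = 1) (d : n → ℝ) (f : ℝ → ℝ) :
    cfc f (conjDiag U d) = conjDiag U (fun i => f (d i)) := by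
  classical
  have hsa : IsSelfAdjoint (conjDiag U d) := by
    rw [isSelfAdjoint_iff, Matrix.star_eq_conjTranspose, Matrix.conjTranspose_eq_transpose_of_trivial]
    exact conjDiag_isSymm U d
  have hfin : (spectrum ℝ (conjDiag U d)).Finite := Matrix.finite_real_spectrum
  -- Interpolating f at the spectrum and at the values of d together makes it unnecessary to
  -- identify the two sets.
  set s : Finset ℝ := hfin.toFinset ∪ Finset.univ.image d with hs
  set Q : Polynomial ℝ := Lagrange.interpolate s id f with hQ
  have hQs : ∀ x ∈ s, Q.eval x = f x := fun x hx =>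
    Lagrange.eval_interpolate_at_node (v := id) f Function.injective_id.injOn hx
  have h1 : cfc f (conjDiag U d) = cfc (fun x => Q.eval x) (conjDiag U d) := by
    refine cfc_congr fun x hx => (hQs x ?_).symm
    rw [hs, Finset.mem_union]
    exact Or.inl (hfin.mem_toFinset.mpr hx)
  rw [h1, cfc_polynomial Q _ hsa, aeval_conjDiag hU]
  congr 1
  ext i
  exact hQs _ (by simp [hs])

theorem exists_conjDiag {A : Matrix n n ℝ} (hA : A.PosDef) :
    ∃ (U : Matrix n n ℝ) (d : n → ℝ), U.transpose * U = 1 ∧ (∀ i, 0 < d i) ∧ A = conjDiag U d := by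
  refine ⟨hA.1.eigenvectorUnitary, hA.1.eigenvalues, ?_, hA.eigenvalues_pos, ?_⟩
  · have := Unitary.coe_star_mul_self hA.1.eigenvectorUnitary
    rwa [Matrix.star_eq_conjTranspose, Matrix.conjTranspose_eq_transpose_of_trivial] at this
  · conv_lhs => rw [hA.1.spectral_theorem]
    rw [Unitary.conjStarAlgAut_apply, Matrix.star_eq_conjTranspose,
      Matrix.conjTranspose_eq_transpose_of_trivial]
    rfl

end Spectral

/-! ### Matrices with nonnegative entries: Perron–Frobenius, logarithm, exponential -/

section Entrywise

variable {n : Type*} [Fintype n] [DecidableEq n]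

theorem hasSum_conjDiag (U : Matrix n n ℝ) {f : ℕ → n → ℝ} {g : n → ℝ}
    (hf : ∀ i, HasSum (fun m => f m i) (g i)) (p q : n) :
    HasSum (fun m => conjDiag U (f m) p q) (conjDiag U g p q) := by
  simp only [conjDiag_apply]
  exact hasSum_sum fun i _ => (hf i).mul_left _

omit [DecidableEq n] in
theorem mul_entry_nonneg {A B : Matrix n n ℝ} (hA : ∀ p q, 0 ≤ A p q) (hB : ∀ p q, 0 ≤ B p q)
    (p q : n) : 0 ≤ (A * B) p q := by
  rw [Matrix.mul_apply]
  exact Finset.sum_nonneg fun r _ => mul_nonneg (hA p r) (hB r q)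

theorem pow_entry_nonneg {A : Matrix n n ℝ} (hA : ∀ p q, 0 ≤ A p q) (m : ℕ) (p q : n) :
    0 ≤ (A ^ m) p q := by
  induction m generalizing p q with
  | zero => rw [pow_zero, Matrix.one_apply]; split_ifs <;> norm_num
  | succ m ih => rw [pow_succ]; exact mul_entry_nonneg ih hA p q

/-- A symmetric matrix with nonnegative entries whose eigenvalues are below `1` has spectral radius
below `1`. -/
theorem abs_lt_one_of_entry_nonneg {U : Matrix n n ℝ} (hU : U.transpose * U = 1) {θ : n → ℝ}
    (hW : ∀ p q, 0 ≤ conjDiag U θ p q) (hθ : ∀ i, θ i < 1) (i : n) : |θ i| < 1 := by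
  have key : ∀ (d y : n → ℝ), ∑ p, ∑ q, y p * conjDiag U d p q * y q
      = ∑ j, d j * (∑ p, U p j * y p) ^ 2 := by
    intro d y
    simp only [conjDiag_apply, sq, Finset.mul_sum, Finset.sum_mul]
    rw [Finset.sum_congr rfl fun p _ => Finset.sum_comm, Finset.sum_comm]
    refine Finset.sum_congr rfl fun j _ => Finset.sum_congr rfl fun p _ =>
      Finset.sum_congr rfl fun q _ => by ring
  have hcol : ∀ j, ∑ p, U p j * U p i = (1 : Matrix n n ℝ) j i := by
    intro j
    rw [← hU, Matrix.mul_apply]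
    rfl
  have hone : ∀ y : n → ℝ, ∑ p, y p ^ 2 = ∑ j, (∑ p, U p j * y p) ^ 2 := by
    intro y
    have h1 := key (fun _ => 1) y
    rw [conjDiag_const hU, one_smul] at h1
    simp only [one_mul] at h1
    rw [← h1]
    refine Finset.sum_congr rfl fun p _ => ?_
    rw [Finset.sum_eq_single p]
    · rw [Matrix.one_apply_eq]; ring
    · intro q _ hq; rw [Matrix.one_apply_ne hq.symm]; ring
    · intro hp; exact absurd (Finset.mem_univ p) hp
  have hu : ∑ p, ∑ q, U p i * conjDiag U θ p q * U q i = θ i := by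
    rw [key θ (fun p => U p i)]
    simp only [hcol]
    rw [Finset.sum_eq_single i (fun j _ hj => by rw [Matrix.one_apply_ne hj]; ring)
      (fun hi => absurd (Finset.mem_univ i) hi), Matrix.one_apply_eq]
    ring
  -- Perron's trick: taking absolute values in the i-th unit eigenvector can only increase the
  -- quadratic form of W, which stays below its largest eigenvalue.
  set y : n → ℝ := fun p => |U p i| with hy
  have hy1 : ∑ p, y p ^ 2 = 1 := by
    have h2 := hcol i
    rw [Matrix.one_apply_eq] at h2
    rw [← h2]
    exact Finset.sum_congr rfl fun p _ => by rw [hy]; simp only [sq_abs]; ring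
  have hle : |θ i| ≤ ∑ p, ∑ q, y p * conjDiag U θ p q * y q := by
    have h3 : θ i = ∑ p, ∑ q, U p i * conjDiag U θ p q * U q i := hu.symm
    rw [h3]
    refine (Finset.abs_sum_le_sum_abs _ _).trans (Finset.sum_le_sum fun p _ => ?_)
    refine (Finset.abs_sum_le_sum_abs _ _).trans (Finset.sum_le_sum fun q _ => ?_)
    rw [abs_mul, abs_mul, abs_of_nonneg (hW p q)]
  refine hle.trans_lt ?_
  have h4 := hone y
  rw [hy1] at h4
  rw [key θ y, h4]
  refine Finset.sum_lt_sum (fun j _ => ?_) ?_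
  · nlinarith [sq_nonneg (∑ p, U p j * y p), hθ j]
  · by_contra! hcon
    have h5 : ∑ j, (∑ p, U p j * y p) ^ 2 ≤ 0 := by
      refine Finset.sum_nonpos fun j hj => ?_
      have := hcon j hj
      nlinarith [hθ j, this]
    linarith

/-- `-log (1 - W)` has nonnegative entries when `W` has. -/
theorem neg_log_one_sub_entry_nonneg {U : Matrix n n ℝ} (hU : U.transpose * U = 1) {θ : n → ℝ}
    (hW : ∀ p q, 0 ≤ conjDiag U θ p q) (hθ : ∀ i, θ i < 1) (p q : n) :
    0 ≤ conjDiag U (fun i => -Real.log (1 - θ i)) p q := by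
  have hs := hasSum_conjDiag U (f := fun m i => θ i ^ (m + 1) / ((m : ℝ) + 1))
    (fun i => Real.hasSum_pow_div_log_of_abs_lt_one (abs_lt_one_of_entry_nonneg hU hW hθ i)) p q
  refine hs.nonneg fun m => ?_
  have h1 : conjDiag U (fun i => θ i ^ (m + 1) / ((m : ℝ) + 1))
      = ((m : ℝ) + 1)⁻¹ • conjDiag U θ ^ (m + 1) := by
    rw [conjDiag_pow hU, conjDiag_smul]
    congr 1
    ext i
    simp only [Pi.smul_apply, Pi.pow_apply, smul_eq_mul]
    ring
  rw [h1, Matrix.smul_apply, smul_eq_mul]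
  exact mul_nonneg (by positivity) (pow_entry_nonneg hW _ p q)

theorem hasSum_exp_conjDiag {U : Matrix n n ℝ} (hU : U.transpose * U = 1) (d : n → ℝ) (a : ℝ)
    (p q : n) :
    HasSum (fun m : ℕ => a ^ m / m.factorial * (conjDiag U d ^ m) p q)
      (NormedSpace.exp (a • conjDiag U d) p q) := by
  rw [conjDiag_smul, exp_conjDiag hU]
  have hs := hasSum_conjDiag U (f := fun m i => (a • d) i ^ m / (m.factorial : ℝ))
    (g := fun i => Real.exp ((a • d) i)) (fun i => by
      have := NormedSpace.expSeries_div_hasSum_exp ((a • d) i)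
      rwa [← Real.exp_eq_exp_ℝ] at this) p q
  convert hs using 2 with m
  rw [conjDiag_pow hU, conjDiag_apply, conjDiag_apply, Finset.mul_sum]
  refine Finset.sum_congr rfl fun i _ => ?_
  simp only [Pi.smul_apply, Pi.pow_apply, smul_eq_mul]
  ring

theorem hasSum_exp_sub_one {U : Matrix n n ℝ} (hU : U.transpose * U = 1) (d : n → ℝ) (a : ℝ)
    (p q : n) :
    HasSum (fun m : ℕ => a ^ (m + 1) / (m + 1).factorial * (conjDiag U d ^ (m + 1)) p q)
      (NormedSpace.exp (a • conjDiag U d) p q - (1 : Matrix n n ℝ) p q) := by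
  have h1 := (hasSum_nat_add_iff' 1).mpr (hasSum_exp_conjDiag hU d a p q)
  simpa using h1

theorem hasSum_exp_sub_one_sub {U : Matrix n n ℝ} (hU : U.transpose * U = 1) (d : n → ℝ) (a : ℝ)
    (p q : n) :
    HasSum (fun m : ℕ => a ^ (m + 2) / (m + 2).factorial * (conjDiag U d ^ (m + 2)) p q)
      (NormedSpace.exp (a • conjDiag U d) p q - (1 : Matrix n n ℝ) p q - a * conjDiag U d p q) := by
  have h1 := (hasSum_nat_add_iff' 1).mpr (hasSum_exp_sub_one hU d a p q)
  simpa using h1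

/-- `|e^{aJ} - 1| ≤ e^J - 1` entrywise. -/
theorem abs_exp_sub_one_le {U : Matrix n n ℝ} (hU : U.transpose * U = 1) {d : n → ℝ}
    (hJ : ∀ p q, 0 ≤ conjDiag U d p q) {a : ℝ} (ha : |a| ≤ 1) (p q : n) :
    |NormedSpace.exp (a • conjDiag U d) p q - (1 : Matrix n n ℝ) p q|
      ≤ NormedSpace.exp (conjDiag U d) p q - (1 : Matrix n n ℝ) p q := by
  have h1 := hasSum_exp_sub_one hU d a p q
  have h2 := hasSum_exp_sub_one hU d 1 p q
  rw [one_smul] at h2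
  rw [← Real.norm_eq_abs, ← h1.tsum_eq]
  refine tsum_of_norm_bounded h2 fun m => ?_
  have h3 := pow_entry_nonneg hJ (m + 1) p q
  rw [Real.norm_eq_abs, abs_mul, abs_of_nonneg h3, abs_div, abs_pow, Nat.abs_cast, one_pow]
  gcongr
  exact pow_le_one₀ (abs_nonneg a) ha

/-- `|e^{aJ} - 1 - aJ| ≤ e^J - 1 - J` entrywise. -/
theorem abs_exp_sub_one_sub_le {U : Matrix n n ℝ} (hU : U.transpose * U = 1) {d : n → ℝ}
    (hJ : ∀ p q, 0 ≤ conjDiag U d p q) {a : ℝ} (ha : |a| ≤ 1) (p q : n) :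
    |NormedSpace.exp (a • conjDiag U d) p q - (1 : Matrix n n ℝ) p q - a * conjDiag U d p q|
      ≤ NormedSpace.exp (conjDiag U d) p q - (1 : Matrix n n ℝ) p q - conjDiag U d p q := by
  have h1 := hasSum_exp_sub_one_sub hU d a p q
  have h2 := hasSum_exp_sub_one_sub hU d 1 p q
  rw [one_smul, one_mul] at h2
  rw [← Real.norm_eq_abs, ← h1.tsum_eq]
  refine tsum_of_norm_bounded h2 fun m => ?_
  have h3 := pow_entry_nonneg hJ (m + 2) p q
  rw [Real.norm_eq_abs, abs_mul, abs_of_nonneg h3, abs_div, abs_pow, Nat.abs_cast, one_pow]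
  gcongr
  exact pow_le_one₀ (abs_nonneg a) ha

/-- `J ≤ e^J - 1` entrywise. -/
theorem le_exp_sub_one {U : Matrix n n ℝ} (hU : U.transpose * U = 1) {d : n → ℝ}
    (hJ : ∀ p q, 0 ≤ conjDiag U d p q) (p q : n) :
    conjDiag U d p q ≤ (NormedSpace.exp (conjDiag U d) - 1) p q := by
  have h2 := abs_exp_sub_one_sub_le hU hJ (a := 1) (by norm_num) p q
  rw [one_smul, one_mul] at h2
  have := (abs_nonneg _).trans h2
  rw [Matrix.sub_apply]
  linarith

/-- `e^J - 1 - J ≤ (e^J - 1)² / 2` entrywise. -/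
theorem exp_sub_one_sub_le {U : Matrix n n ℝ} (hU : U.transpose * U = 1) {d : n → ℝ}
    (hJ : ∀ p q, 0 ≤ conjDiag U d p q) (p q : n) :
    (NormedSpace.exp (conjDiag U d) - 1) p q - conjDiag U d p q
      ≤ ((NormedSpace.exp (conjDiag U d) - 1) * (NormedSpace.exp (conjDiag U d) - 1)) p q / 2 := by
  have h2 := hasSum_exp_sub_one_sub hU d 1 p q
  simp only [one_smul, one_mul, one_pow] at h2
  have hZ : ∀ p q, 0 ≤ (NormedSpace.exp (conjDiag U d) - 1) p q := fun p q =>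
    (hJ p q).trans (le_exp_sub_one hU hJ p q)
  have h3 : HasSum (fun m : ℕ => (1 : ℝ) / (m + 1).factorial * (conjDiag U d ^ (m + 2)) p q)
      ((conjDiag U d * (NormedSpace.exp (conjDiag U d) - 1)) p q) := by
    rw [Matrix.mul_apply]
    have h4 : ∀ m : ℕ, (1 : ℝ) / (m + 1).factorial * (conjDiag U d ^ (m + 2)) p q
        = ∑ r, conjDiag U d p r * ((1 : ℝ) / (m + 1).factorial * (conjDiag U d ^ (m + 1)) r q) := by
      intro m
      rw [pow_succ', Matrix.mul_apply, Finset.mul_sum]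
      exact Finset.sum_congr rfl fun r _ => by ring
    simp only [h4]
    refine hasSum_sum fun r _ => HasSum.mul_left _ ?_
    have h5 := hasSum_exp_sub_one hU d 1 r q
    simp only [one_smul, one_pow] at h5
    exact h5
  -- The intermediate bound is e^J - 1 - J ≤ J(e^J - 1)/2, term by term from (m+2)! ≥ 2 (m+1)!;
  -- afterwards J ≤ e^J - 1.
  have h6 : (NormedSpace.exp (conjDiag U d) - 1) p q - conjDiag U d p q
      ≤ (conjDiag U d * (NormedSpace.exp (conjDiag U d) - 1)) p q / 2 := by
    refine hasSum_le (fun m => ?_) h2 (h3.div_const 2)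
    have h7 := pow_entry_nonneg hJ (m + 2) p q
    have h8 : (1 : ℝ) / (m + 2).factorial ≤ 1 / (m + 1).factorial / 2 := by
      rw [div_div]
      refine one_div_le_one_div_of_le (by positivity) ?_
      rw [Nat.factorial_succ (m + 1)]
      push_cast
      have : (0 : ℝ) < (m + 1).factorial := by positivity
      nlinarith [Nat.cast_nonneg (α := ℝ) m]
    calc (1 : ℝ) / (m + 2).factorial * (conjDiag U d ^ (m + 2)) p q
        ≤ 1 / (m + 1).factorial / 2 * (conjDiag U d ^ (m + 2)) p q :=
          mul_le_mul_of_nonneg_right h8 h7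
      _ = _ := by ring
  refine h6.trans (div_le_div_of_nonneg_right ?_ (by norm_num))
  rw [Matrix.mul_apply, Matrix.mul_apply]
  exact Finset.sum_le_sum fun r _ =>
    mul_le_mul_of_nonneg_right (le_exp_sub_one hU hJ p r) (hZ r q)

end Entrywise

/-! ### Resolvent, inverse square root and determinant of a rank-one perturbation -/

section SquareRoot

theorem integrableOn_inv_sq_add_sq {a : ℝ} (ha : 0 < a) :
    MeasureTheory.IntegrableOn (fun t : ℝ => (a ^ 2 + t ^ 2)⁻¹) (Set.Ioi 0) := by
  have h1 : MeasureTheory.Integrable (fun t : ℝ => (a ^ 2)⁻¹ * (1 + (a⁻¹ * t) ^ 2)⁻¹) :=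
    ((integrable_inv_one_add_sq).comp_mul_left' (inv_ne_zero ha.ne')).const_mul _
  refine (h1.congr (Filter.Eventually.of_forall fun t => ?_)).integrableOn
  have : a ^ 2 + t ^ 2 ≠ 0 := by positivity
  have : 1 + (a⁻¹ * t) ^ 2 ≠ 0 := by positivity
  field_simp

/-- With a² an eigenvalue of E² or h², this expresses the inverse square root as an integral of
resolvents, the form in which Sherman–Morrison can be used. -/
theorem integral_inv_sq_add_sq {a : ℝ} (ha : 0 < a) :
    ∫ t in Set.Ioi (0 : ℝ), (a ^ 2 + t ^ 2)⁻¹ = Real.pi / 2 * a⁻¹ := by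
  have h1 : ∀ t : ℝ, (a ^ 2 + t ^ 2)⁻¹ = (a ^ 2)⁻¹ * (1 + (a⁻¹ * t) ^ 2)⁻¹ := by
    intro t
    have : a ^ 2 + t ^ 2 ≠ 0 := by positivity
    have : 1 + (a⁻¹ * t) ^ 2 ≠ 0 := by positivity
    field_simp
  simp only [h1]
  rw [MeasureTheory.integral_const_mul,
    MeasureTheory.integral_comp_mul_left_Ioi (fun x => (1 + x ^ 2)⁻¹) 0 (inv_pos.mpr ha), mul_zero,
    integral_Ioi_inv_one_add_sq, Real.arctan_zero, inv_inv, smul_eq_mul]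
  field_simp
  ring

variable {n : Type*} [Fintype n] [DecidableEq n]

/-- The matrix `diag(λ²) + 2 c w wᵀ` with `w_p = λ_p^{1/2}`. -/
noncomputable def rankOnePert (lam : n → ℝ) (c : ℝ) : Matrix n n ℝ :=
  Matrix.diagonal (fun p => lam p ^ 2) +
    (2 * c) • Matrix.vecMulVec (fun p => √(lam p)) (fun p => √(lam p))

/-- `g(t) = c ∑ λ / (λ² + t²)`. -/
noncomputable def resolventForm (lam : n → ℝ) (c t : ℝ) : ℝ := c * ∑ p, lam p / (lam p ^ 2 + t ^ 2)

omit [DecidableEq n] in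
theorem resolventForm_nonneg {lam : n → ℝ} (hlam : ∀ p, 0 < lam p) {c : ℝ} (hc : 0 ≤ c) (t : ℝ) :
    0 ≤ resolventForm lam c t :=
  mul_nonneg hc (Finset.sum_nonneg fun p _ => by have := hlam p; positivity)

theorem rankOnePert_posDef {lam : n → ℝ} (hlam : ∀ p, 0 < lam p) {c : ℝ} (hc : 0 ≤ c) :
    (rankOnePert lam c).PosDef := by
  refine Matrix.PosDef.add_posSemidef (Matrix.PosDef.diagonal fun p => pow_pos (hlam p) 2) ?_
  refine Matrix.PosSemidef.smul ?_ (by positivity)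
  have := Matrix.posSemidef_vecMulVec_self_star (fun p => √(lam p))
  simpa using this

/-- The Sherman–Morrison formula for the resolvent of `rankOnePert`. -/
theorem rankOnePert_resolvent {lam : n → ℝ} (hlam : ∀ p, 0 < lam p) {c : ℝ} (hc : 0 ≤ c) {t : ℝ}
    {U : Matrix n n ℝ} {m : n → ℝ} (hU : U.transpose * U = 1) (hm : ∀ i, 0 < m i)
    (hM : rankOnePert lam c = conjDiag U m) :
    conjDiag U (fun i => (m i + t ^ 2)⁻¹)
      = Matrix.diagonal (fun p => (lam p ^ 2 + t ^ 2)⁻¹)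
        - (2 * c / (1 + 2 * resolventForm lam c t)) •
          Matrix.vecMulVec (fun p => √(lam p) / (lam p ^ 2 + t ^ 2))
            (fun p => √(lam p) / (lam p ^ 2 + t ^ 2)) := by
  set g := resolventForm lam c t with hg
  have hg0 : 0 ≤ g := resolventForm_nonneg hlam hc t
  set B := Matrix.diagonal (fun p => (lam p ^ 2 + t ^ 2)⁻¹)
        - (2 * c / (1 + 2 * g)) •
          Matrix.vecMulVec (fun p => √(lam p) / (lam p ^ 2 + t ^ 2))
            (fun p => √(lam p) / (lam p ^ 2 + t ^ 2)) with hB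
  have hsum : conjDiag U (fun i => m i + t ^ 2)
      = rankOnePert lam c + t ^ 2 • (1 : Matrix n n ℝ) := by
    rw [hM, ← conjDiag_const hU, conjDiag_add]
    rfl
  have h1 : conjDiag U (fun i => (m i + t ^ 2)⁻¹) * conjDiag U (fun i => m i + t ^ 2) = 1 := by
    rw [conjDiag_mul hU, ← one_smul ℝ (1 : Matrix n n ℝ), ← conjDiag_const hU]
    congr 1
    ext i
    have := hm i
    exact inv_mul_cancel₀ (by positivity)
  have h2 : conjDiag U (fun i => m i + t ^ 2) * B = 1 := by
    rw [hsum]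
    have hA : rankOnePert lam c + t ^ 2 • (1 : Matrix n n ℝ)
        = Matrix.diagonal (fun p => lam p ^ 2 + t ^ 2) +
          (2 * c) • Matrix.vecMulVec (fun p => √(lam p)) (fun p => √(lam p)) := by
      rw [rankOnePert, Matrix.smul_one_eq_diagonal, add_right_comm, Matrix.diagonal_add]
    rw [hA]
    have hw : ∑ p, √(lam p) * (√(lam p) / (lam p ^ 2 + t ^ 2)) * c = g := by
      rw [hg, resolventForm, Finset.mul_sum]
      refine Finset.sum_congr rfl fun p _ => ?_
      rw [← mul_div_assoc, Real.mul_self_sqrt (hlam p).le, mul_comm]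
    ext p q
    have hne : ∀ p, lam p ^ 2 + t ^ 2 ≠ 0 := fun p => by have := hlam p; positivity
    have e1 : (Matrix.diagonal (fun p => lam p ^ 2 + t ^ 2) * B) p q
        = (1 : Matrix n n ℝ) p q
          - 2 * c / (1 + 2 * g) * (√(lam p) * (√(lam q) / (lam q ^ 2 + t ^ 2))) := by
      rw [Matrix.diagonal_mul, hB, Matrix.sub_apply, Matrix.smul_apply, Matrix.vecMulVec_apply,
        smul_eq_mul, mul_sub, Matrix.diagonal_apply, Matrix.one_apply]
      have := hne p
      congr 1
      · split_ifs
        · exact mul_inv_cancel₀ this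
        · exact mul_zero _
      · field_simp
    have e2 : ((2 * c) • Matrix.vecMulVec (fun p => √(lam p)) (fun p => √(lam p)) * B) p q
        = 2 * c * √(lam p) * (√(lam q) / (lam q ^ 2 + t ^ 2))
          - 2 * c * √(lam p) * (2 / (1 + 2 * g)) * (√(lam q) / (lam q ^ 2 + t ^ 2)) * g := by
      rw [Matrix.smul_mul, Matrix.smul_apply, smul_eq_mul, Matrix.mul_apply]
      simp only [Matrix.vecMulVec_apply]
      have e3 : ∀ r, √(lam p) * √(lam r) * B r q = √(lam p) * (√(lam r) *
          Matrix.diagonal (fun p => (lam p ^ 2 + t ^ 2)⁻¹) r q)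
          - √(lam p) * (2 / (1 + 2 * g)) * (√(lam q) / (lam q ^ 2 + t ^ 2)) *
            (√(lam r) * (√(lam r) / (lam r ^ 2 + t ^ 2)) * c) := by
        intro r
        rw [hB, Matrix.sub_apply, Matrix.smul_apply, Matrix.vecMulVec_apply, smul_eq_mul]
        ring
      simp only [e3]
      rw [Finset.sum_sub_distrib, ← Finset.mul_sum, ← Finset.mul_sum, hw]
      have e4 : ∑ r, √(lam r) * Matrix.diagonal (fun p => (lam p ^ 2 + t ^ 2)⁻¹) r q
          = √(lam q) / (lam q ^ 2 + t ^ 2) := by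
        rw [Finset.sum_eq_single q]
        · rw [Matrix.diagonal_apply_eq]; rfl
        · intro r _ hr; rw [Matrix.diagonal_apply_ne _ hr, mul_zero]
        · intro hq; exact absurd (Finset.mem_univ q) hq
      rw [e4]
      ring
    rw [Matrix.add_mul, Matrix.add_apply, e1, e2]
    have : 1 + 2 * g ≠ 0 := by positivity
    have := hne q
    field_simp
    ring
  calc conjDiag U (fun i => (m i + t ^ 2)⁻¹)
      = conjDiag U (fun i => (m i + t ^ 2)⁻¹) * (conjDiag U (fun i => m i + t ^ 2) * B) := by
        rw [h2, Matrix.mul_one]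
    _ = B := by rw [← Matrix.mul_assoc, h1, Matrix.one_mul]

/-- `(h² + 2 c w wᵀ)^{-1/2} ≤ h⁻¹` entrywise. -/
theorem rankOnePert_inv_sqrt_le {lam : n → ℝ} (hlam : ∀ p, 0 < lam p) {c : ℝ} (hc : 0 ≤ c)
    {U : Matrix n n ℝ} {m : n → ℝ} (hU : U.transpose * U = 1) (hm : ∀ i, 0 < m i)
    (hM : rankOnePert lam c = conjDiag U m) (p q : n) :
    conjDiag U (fun i => (√(m i))⁻¹) p q ≤ Matrix.diagonal (fun p => (lam p)⁻¹) p q := by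
  have key : ∀ (a : n → ℝ), (∀ i, 0 < a i) → ∀ V : Matrix n n ℝ,
      MeasureTheory.IntegrableOn
        (fun t : ℝ => conjDiag V (fun i => (a i ^ 2 + t ^ 2)⁻¹) p q) (Set.Ioi 0) ∧
      ∫ t in Set.Ioi (0 : ℝ), conjDiag V (fun i => (a i ^ 2 + t ^ 2)⁻¹) p q
        = Real.pi / 2 * conjDiag V (fun i => (a i)⁻¹) p q := by
    intro a ha V
    have hint : ∀ i ∈ Finset.univ, MeasureTheory.Integrable
        (fun t : ℝ => V p i * V q i * (a i ^ 2 + t ^ 2)⁻¹)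
        (MeasureTheory.volume.restrict (Set.Ioi 0)) := fun i _ =>
      (integrableOn_inv_sq_add_sq (ha i)).const_mul _
    simp only [conjDiag_apply]
    refine ⟨MeasureTheory.integrable_finsetSum _ hint, ?_⟩
    rw [MeasureTheory.integral_finsetSum _ hint, Finset.mul_sum]
    refine Finset.sum_congr rfl fun i _ => ?_
    rw [MeasureTheory.integral_const_mul, integral_inv_sq_add_sq (ha i)]
    ring
  obtain ⟨i1, e1⟩ := key (fun i => √(m i)) (fun i => Real.sqrt_pos.mpr (hm i)) U
  obtain ⟨i2, e2⟩ := key lam hlam 1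
  rw [conjDiag_one_left] at e2
  -- The two resolvents differ by a rank-one matrix with nonnegative entries, so the comparison
  -- holds at each t and survives integration.
  have hle : ∫ t in Set.Ioi (0 : ℝ), conjDiag U (fun i => (√(m i) ^ 2 + t ^ 2)⁻¹) p q
      ≤ ∫ t in Set.Ioi (0 : ℝ), conjDiag 1 (fun i => (lam i ^ 2 + t ^ 2)⁻¹) p q := by
    refine MeasureTheory.integral_mono i1 i2 fun t => ?_
    have h1 : (fun i => (√(m i) ^ 2 + t ^ 2)⁻¹) = fun i => (m i + t ^ 2)⁻¹ := by
      ext i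
      rw [Real.sq_sqrt (hm i).le]
    simp only [h1]
    rw [rankOnePert_resolvent hlam hc hU hm hM, conjDiag_one_left, Matrix.sub_apply,
      Matrix.smul_apply, Matrix.vecMulVec_apply, smul_eq_mul]
    have hg := resolventForm_nonneg hlam hc t
    have hp := hlam p
    have hq := hlam q
    have : 0 ≤ 2 * c / (1 + 2 * resolventForm lam c t) *
      (√(lam p) / (lam p ^ 2 + t ^ 2) * (√(lam q) / (lam q ^ 2 + t ^ 2))) := by positivity
    linarith
  rw [e1, e2] at hle
  exact le_of_mul_le_mul_left hle (by positivity)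

/-- The eigenvalues of `rankOnePert` in terms of the resolvent form. -/
theorem prod_eigenvalues_rankOnePert {lam : n → ℝ} (hlam : ∀ p, 0 < lam p) {c : ℝ}
    {U : Matrix n n ℝ} {m : n → ℝ} (hU : U.transpose * U = 1)
    (hM : rankOnePert lam c = conjDiag U m) (t : ℝ) :
    ∏ i, (m i + t ^ 2)
      = (∏ p, (lam p ^ 2 + t ^ 2)) * (1 + 2 * resolventForm lam c t) := by
  have hne : ∀ p, lam p ^ 2 + t ^ 2 ≠ 0 := fun p => by have := hlam p; positivity
  have hsum : conjDiag U (fun i => m i + t ^ 2)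
      = Matrix.diagonal (fun p => lam p ^ 2 + t ^ 2) +
        Matrix.replicateCol Unit (fun p => 2 * c * √(lam p)) *
          Matrix.replicateRow Unit (fun p => √(lam p)) := by
    have h1 : conjDiag U (fun i => m i + t ^ 2)
        = rankOnePert lam c + t ^ 2 • (1 : Matrix n n ℝ) := by
      rw [hM, ← conjDiag_const hU, conjDiag_add]
      rfl
    rw [h1, rankOnePert, Matrix.smul_one_eq_diagonal, add_right_comm, Matrix.diagonal_add]
    congr 1
    ext p q
    simp [Matrix.vecMulVec_apply, Matrix.mul_apply, mul_assoc]
  rw [← det_conjDiag hU, hsum, Matrix.det_add_replicateCol_mul_replicateRow, Matrix.det_diagonal]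
  · congr 1
    rw [Matrix.det_unique, Matrix.add_apply, Matrix.one_apply_eq, Matrix.mul_assoc,
      Matrix.mul_apply]
    congr 1
    rw [resolventForm, Finset.mul_sum, Finset.mul_sum]
    refine Finset.sum_congr rfl fun p _ => ?_
    rw [Matrix.inv_eq_left_inv (B := Matrix.diagonal (fun p => (lam p ^ 2 + t ^ 2)⁻¹)),
      Matrix.diagonal_mul, Matrix.replicateRow_apply, Matrix.replicateCol_apply]
    · have := Real.mul_self_sqrt (hlam p).le
      calc √(lam p) * ((lam p ^ 2 + t ^ 2)⁻¹ * (2 * c * √(lam p)))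
          = 2 * c * (√(lam p) * √(lam p)) * (lam p ^ 2 + t ^ 2)⁻¹ := by ring
        _ = _ := by rw [this]; ring
    · rw [Matrix.diagonal_mul_diagonal, ← Matrix.diagonal_one]
      congr 1
      ext p
      exact inv_mul_cancel₀ (hne p)
  · rw [Matrix.det_diagonal]
    exact (Finset.prod_ne_zero_iff.mpr fun p _ => hne p).isUnit

end SquareRoot

/-! ### Positivity of the logarithm and the Riccati equation -/

section Logarithm

variable {n : Type*} [Fintype n] [DecidableEq n]

theorem rpow_diagonal (lam : n → ℝ) (r : ℝ) :
    cfc (fun x : ℝ => x ^ r) (Matrix.diagonal lam) = Matrix.diagonal (fun p => lam p ^ r) := by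
  rw [← conjDiag_one_left, cfc_conjDiag (by simp), conjDiag_one_left]

/-- The structure of `log (h^{-1/2} (h^{1/2} (h + 2P) h^{1/2})^{1/2} h^{-1/2})`. -/
theorem exists_log_structure {lam : n → ℝ} (hlam : ∀ p, 0 < lam p) (v : ℝ) :
    ∃ (U : Matrix n n ℝ) (d : n → ℝ) (m : n → ℝ), U.transpose * U = 1 ∧
      (∀ p q, 0 ≤ conjDiag U d p q) ∧
      cfc Real.log (cfc (fun x : ℝ => x ^ (-(1 / 2) : ℝ)) (Matrix.diagonal lam) *
        cfc (fun x : ℝ => x ^ (1 / 2 : ℝ)) (cfc (fun x : ℝ => x ^ (1 / 2 : ℝ)) (Matrix.diagonal lam)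
          * (Matrix.diagonal lam + (2 : ℝ) • Matrix.vecMulVec (fun _ => v) (fun _ => v))
          * cfc (fun x : ℝ => x ^ (1 / 2 : ℝ)) (Matrix.diagonal lam)) *
        cfc (fun x : ℝ => x ^ (-(1 / 2) : ℝ)) (Matrix.diagonal lam)) = conjDiag U d ∧
      (∀ p q, √(lam p) * (NormedSpace.exp (conjDiag U d) - 1) p q * √(lam q) * (lam p + lam q)
        + ∑ r, (√(lam p) * (NormedSpace.exp (conjDiag U d) - 1) p r * √(lam r)) *
            (√(lam r) * (NormedSpace.exp (conjDiag U d) - 1) r q * √(lam q))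
        = 2 * v ^ 2 * √(lam p) * √(lam q)) ∧
      (∀ i, 0 < m i) ∧
      ∑ p, lam p * NormedSpace.exp (conjDiag U d) p p = ∑ i, √(m i) ∧
      ∀ t : ℝ, ∏ i, (m i + t ^ 2)
        = (∏ p, (lam p ^ 2 + t ^ 2)) * (1 + 2 * resolventForm lam (v ^ 2) t) := by
  have hv : 0 ≤ v ^ 2 := sq_nonneg v
  have hs : ∀ p, √(lam p) * √(lam p) = lam p := fun p => Real.mul_self_sqrt (hlam p).le
  have hs0 : ∀ p, 0 < √(lam p) := fun p => Real.sqrt_pos.mpr (hlam p)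
  obtain ⟨U₁, m, hU₁, hm, hM⟩ := exists_conjDiag (rankOnePert_posDef hlam hv)
  have hhalf : (fun p => lam p ^ (1 / 2 : ℝ)) = fun p => √(lam p) := by
    ext p; rw [Real.sqrt_eq_rpow]
  have hnhalf : (fun p => lam p ^ (-(1 / 2) : ℝ)) = fun p => (√(lam p))⁻¹ := by
    ext p; rw [Real.rpow_neg (hlam p).le, Real.sqrt_eq_rpow]
  have hM' : Matrix.diagonal (fun p => √(lam p))
      * (Matrix.diagonal lam + (2 : ℝ) • Matrix.vecMulVec (fun _ => v) (fun _ => v))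
      * Matrix.diagonal (fun p => √(lam p)) = rankOnePert lam (v ^ 2) := by
    ext p q
    rw [Matrix.mul_diagonal, Matrix.diagonal_mul, rankOnePert, Matrix.add_apply, Matrix.add_apply,
      Matrix.smul_apply, Matrix.smul_apply, Matrix.vecMulVec_apply, Matrix.vecMulVec_apply,
      Matrix.diagonal_apply, Matrix.diagonal_apply, smul_eq_mul, smul_eq_mul]
    split_ifs with hpq
    · subst hpq
      linear_combination (lam p) * hs p
    · ring
  rw [rpow_diagonal, rpow_diagonal, hhalf, hnhalf, hM', hM, cfc_conjDiag hU₁]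
  set E := conjDiag U₁ (fun i => m i ^ (1 / 2 : ℝ)) with hE
  have hEs : E = conjDiag U₁ (fun i => √(m i)) := by
    rw [hE]; congr 1; ext i; rw [Real.sqrt_eq_rpow]
  set N := Matrix.diagonal (fun p => (√(lam p))⁻¹) * E * Matrix.diagonal (fun p => (√(lam p))⁻¹)
    with hN
  have hNpq : ∀ p q, N p q = (√(lam p))⁻¹ * E p q * (√(lam q))⁻¹ := fun p q => by
    rw [hN, Matrix.mul_diagonal, Matrix.diagonal_mul]
  have hEpos : E.PosDef := by
    have hu : IsUnit U₁.transpose := IsUnit.of_mul_eq_one _ hU₁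
    have := (Matrix.PosDef.diagonal (fun i => Real.sqrt_pos.mpr (hm i))).conjTranspose_mul_mul_same
      (Matrix.mulVec_injective_iff_isUnit.mpr hu)
    rw [hEs]
    rwa [Matrix.conjTranspose_eq_transpose_of_trivial, Matrix.transpose_transpose] at this
  have hNpos : N.PosDef := by
    have hu : IsUnit (Matrix.diagonal (fun p => (√(lam p))⁻¹)) := by
      rw [Matrix.isUnit_diagonal, Pi.isUnit_iff]
      exact fun p => (inv_ne_zero (hs0 p).ne').isUnit
    have := hEpos.conjTranspose_mul_mul_same (Matrix.mulVec_injective_iff_isUnit.mpr hu)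
    rwa [Matrix.conjTranspose_eq_transpose_of_trivial, Matrix.diagonal_transpose] at this
  obtain ⟨U, ν, hU, hν, hNU⟩ := exists_conjDiag hNpos
  have hlog : cfc Real.log N = conjDiag U (fun i => Real.log (ν i)) := by
    rw [hNU, cfc_conjDiag hU]
  have hexp : NormedSpace.exp (conjDiag U (fun i => Real.log (ν i))) = N := by
    rw [exp_conjDiag hU, hNU]
    congr 1; ext i; exact Real.exp_log (hν i)
  set Ei := conjDiag U₁ (fun i => (√(m i))⁻¹) with hEi
  have hEEi : E * Ei = 1 := by
    rw [hEs, hEi, conjDiag_mul hU₁, ← one_smul ℝ (1 : Matrix n n ℝ), ← conjDiag_const hU₁]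
    congr 1; ext i; exact mul_inv_cancel₀ (Real.sqrt_pos.mpr (hm i)).ne'
  have hNinv : conjDiag U (fun i => (ν i)⁻¹)
      = Matrix.diagonal (fun p => √(lam p)) * Ei * Matrix.diagonal (fun p => √(lam p)) := by
    have h1 : conjDiag U (fun i => (ν i)⁻¹) * N = 1 := by
      rw [hNU, conjDiag_mul hU, ← one_smul ℝ (1 : Matrix n n ℝ), ← conjDiag_const hU]
      congr 1; ext i; exact inv_mul_cancel₀ (hν i).ne'
    have hD : Matrix.diagonal (fun p => (√(lam p))⁻¹) * Matrix.diagonal (fun p => √(lam p))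
        = 1 := by
      rw [Matrix.diagonal_mul_diagonal, ← Matrix.diagonal_one]
      congr 1; ext p; exact inv_mul_cancel₀ (hs0 p).ne'
    have h2 : N * (Matrix.diagonal (fun p => √(lam p)) * Ei *
        Matrix.diagonal (fun p => √(lam p))) = 1 := by
      calc _ = Matrix.diagonal (fun p => (√(lam p))⁻¹) * (E *
            ((Matrix.diagonal (fun p => (√(lam p))⁻¹) * Matrix.diagonal (fun p => √(lam p))) *
              Ei)) * Matrix.diagonal (fun p => √(lam p)) := by
            simp only [hN, Matrix.mul_assoc]
        _ = 1 := by rw [hD, Matrix.one_mul, hEEi, Matrix.mul_one, hD]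
    calc _ = conjDiag U (fun i => (ν i)⁻¹) * (N * (Matrix.diagonal (fun p => √(lam p)) * Ei *
        Matrix.diagonal (fun p => √(lam p)))) := by rw [h2, Matrix.mul_one]
      _ = _ := by rw [← Matrix.mul_assoc, h1, Matrix.one_mul]
  -- W = 1 - N⁻¹ = 1 - h^{1/2} E⁻¹ h^{1/2}, and E⁻¹ ≤ h⁻¹ entrywise. The eigenvalues 1 - 1/ν_i of W
  -- are below 1 because N is positive definite, so log N = -log(1 - W) has a convergent expansion
  -- in powers of W.
  have hW : ∀ p q, 0 ≤ conjDiag U (fun i => 1 - (ν i)⁻¹) p q := by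
    intro p q
    have h1 : conjDiag U (fun i => 1 - (ν i)⁻¹) p q
        = (1 : Matrix n n ℝ) p q - conjDiag U (fun i => (ν i)⁻¹) p q := by
      have := congrFun (congrFun (conjDiag_add U (fun i => 1 - (ν i)⁻¹) (fun i => (ν i)⁻¹)) p) q
      have h3 : ((fun i => 1 - (ν i)⁻¹) + fun i => (ν i)⁻¹) = fun _ => (1 : ℝ) := by
        ext i; simp
      rw [h3, conjDiag_const hU, one_smul, Matrix.add_apply] at this
      linarith
    have h2 := rankOnePert_inv_sqrt_le hlam hv hU₁ hm hM p q
    rw [h1, hNinv, Matrix.mul_diagonal, Matrix.diagonal_mul, sub_nonneg]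
    calc √(lam p) * Ei p q * √(lam q)
        ≤ √(lam p) * Matrix.diagonal (fun p => (lam p)⁻¹) p q * √(lam q) := by
          gcongr
      _ = (1 : Matrix n n ℝ) p q := by
          rw [Matrix.diagonal_apply, Matrix.one_apply]
          split_ifs with hpq
          · subst hpq
            rw [mul_right_comm, hs]
            exact mul_inv_cancel₀ (hlam p).ne'
          · ring
  refine ⟨U, fun i => Real.log (ν i), m, hU, ?_, hlog, ?_, hm, ?_,
    prod_eigenvalues_rankOnePert hlam hU₁ hM⟩
  · intro p q
    have h1 := neg_log_one_sub_entry_nonneg hU hW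
      (fun i => by have := inv_pos.mpr (hν i); linarith) p q
    convert h1 using 3 with i
    rw [sub_sub_cancel, Real.log_inv, neg_neg]
  · rw [hexp]
    have hX : ∀ p q, √(lam p) * (N - 1) p q * √(lam q) = (E - Matrix.diagonal lam) p q := by
      intro p q
      rw [Matrix.sub_apply, Matrix.sub_apply, hNpq, Matrix.one_apply, Matrix.diagonal_apply]
      have := hs0 p
      have := hs0 q
      split_ifs with hpq
      · subst hpq
        field_simp
        rw [Real.sq_sqrt (hlam p).le]
      · field_simp
        ring
    intro p q
    simp only [hX]
    rw [← Matrix.mul_apply]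
    have hE2 : E * E = rankOnePert lam (v ^ 2) := by
      rw [hEs, conjDiag_mul hU₁, hM]
      congr 1; ext i; exact Real.mul_self_sqrt (hm i).le
    -- With X = E - h = h^{1/2}(N - 1)h^{1/2}, expanding X² makes the entries of E h + h E supply
    -- the factor λ_p + λ_q and leaves X² + hX + Xh = 2b w wᵀ.
    have h1 : (E - Matrix.diagonal lam) * (E - Matrix.diagonal lam)
        = rankOnePert lam (v ^ 2) - E * Matrix.diagonal lam - Matrix.diagonal lam * E
          + Matrix.diagonal (fun p => lam p ^ 2) := by
      rw [← hE2, Matrix.sub_mul, Matrix.mul_sub, Matrix.mul_sub, Matrix.diagonal_mul_diagonal]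
      simp only [sq]
      abel
    rw [h1, Matrix.add_apply, Matrix.sub_apply, Matrix.sub_apply, Matrix.sub_apply,
      Matrix.mul_diagonal, Matrix.diagonal_mul, rankOnePert, Matrix.add_apply, Matrix.smul_apply,
      Matrix.vecMulVec_apply, smul_eq_mul, Matrix.diagonal_apply, Matrix.diagonal_apply]
    split_ifs with hpq
    · subst hpq; ring
    · ring
  · rw [hexp, ← trace_conjDiag hU₁ (fun i => √(m i)), ← hEs, Matrix.trace]
    refine Finset.sum_congr rfl fun p _ => ?_
    rw [hNpq, Matrix.diag_apply]
    have := hs0 p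
    field_simp
    rw [Real.sq_sqrt (hlam p).le, mul_comm]

end Logarithm

/-! ### Entry bounds from the Riccati equation -/

section EntryBounds

variable {n : Type*} [Fintype n] [DecidableEq n]

/-- Expanding, (a + r)(r + b) ≥ r(a + b). Summed over r, this reproduces the decay 1/(λ_p + λ_q) at
the cost of a factor ∑ λ_r⁻¹. -/
theorem div_add_mul_div_add_le {a b r x : ℝ} (ha : 0 < a) (hb : 0 < b) (hr : 0 < r) (hx : 0 ≤ x) :
    x / (a + r) * (x / (r + b)) ≤ x * x / r / (a + b) := by
  rw [div_mul_div_comm, div_div]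
  refine div_le_div_of_nonneg_left (mul_nonneg hx hx) (by positivity) ?_
  nlinarith [mul_pos ha hr, mul_pos ha hb, mul_pos hr hr]

omit [DecidableEq n] in
/-- Entrywise decay `x / (λ_p + λ_q)` gives the same decay for products. -/
theorem mul_entry_le {lam : n → ℝ} (hlam : ∀ p, 0 < lam p) {x : ℝ} (hx : 0 ≤ x)
    {S T : Matrix n n ℝ} (hS : ∀ p q, |S p q| ≤ x / (lam p + lam q))
    (hT : ∀ p q, |T p q| ≤ x / (lam p + lam q)) (p q : n) :
    |(S * T) p q| ≤ x * (x * ∑ r, (lam r)⁻¹) / (lam p + lam q) := by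
  rw [Matrix.mul_apply]
  refine (Finset.abs_sum_le_sum_abs _ _).trans ?_
  rw [Finset.mul_sum, Finset.mul_sum, Finset.sum_div]
  refine Finset.sum_le_sum fun r _ => ?_
  rw [abs_mul]
  have hp := hlam p
  have hr := hlam r
  have hq := hlam q
  refine (mul_le_mul (hS p r) (hT r q) (abs_nonneg _) (by positivity)).trans ?_
  refine (div_add_mul_div_add_le hp hq hr hx).trans (le_of_eq ?_)
  ring

-- Each of the two factors decays at least like 1/λ_r, so one power of λ_r⁻¹ is left after the
-- weight. This controls the quadratic term of the Riccati equation and of (1 + S)h(1 + S), where no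
-- decay in λ_p + λ_q is needed.
omit [DecidableEq n] in
theorem mul_weight_mul_entry_le {lam : n → ℝ} (hlam : ∀ p, 0 < lam p) {x : ℝ} (hx : 0 ≤ x)
    {S T : Matrix n n ℝ} (hS : ∀ p q, |S p q| ≤ x / (lam p + lam q))
    (hT : ∀ p q, |T p q| ≤ x / (lam p + lam q)) (p q : n) :
    |∑ r, lam r * S p r * T r q| ≤ x * (x * ∑ r, (lam r)⁻¹) := by
  refine (Finset.abs_sum_le_sum_abs _ _).trans ?_
  rw [Finset.mul_sum, Finset.mul_sum]
  refine Finset.sum_le_sum fun r _ => ?_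
  have hp := hlam p
  have hr := hlam r
  have hq := hlam q
  rw [abs_mul, abs_mul, abs_of_pos hr]
  have h1 : |S p r| ≤ x / lam r :=
    (hS p r).trans (div_le_div_of_nonneg_left hx hr (by linarith))
  have h2 : |T r q| ≤ x / lam r :=
    (hT r q).trans (div_le_div_of_nonneg_left hx hr (by linarith))
  calc lam r * |S p r| * |T r q| ≤ lam r * (x / lam r) * (x / lam r) := by gcongr
    _ = x * (x * (lam r)⁻¹) := by field_simp

/-- Bounds for `J` and `Z = e^J - 1` solving the Riccati equation. -/
theorem log_entry_bounds {lam : n → ℝ} (hlam : ∀ p, 0 < lam p) {v : ℝ}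
    {U : Matrix n n ℝ} {d : n → ℝ} (hU : U.transpose * U = 1)
    (hJ : ∀ p q, 0 ≤ conjDiag U d p q)
    (hric : ∀ p q, √(lam p) * (NormedSpace.exp (conjDiag U d) - 1) p q * √(lam q) * (lam p + lam q)
        + ∑ r, (√(lam p) * (NormedSpace.exp (conjDiag U d) - 1) p r * √(lam r)) *
            (√(lam r) * (NormedSpace.exp (conjDiag U d) - 1) r q * √(lam q))
        = 2 * v ^ 2 * √(lam p) * √(lam q)) (p q : n) :
    (NormedSpace.exp (conjDiag U d) - 1) p q ≤ 2 * v ^ 2 / (lam p + lam q) ∧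
    (NormedSpace.exp (conjDiag U d) - 1) p q - conjDiag U d p q
      ≤ 2 * v ^ 2 * (v ^ 2 * ∑ r, (lam r)⁻¹) / (lam p + lam q) ∧
    (2 * v ^ 2 - 4 * v ^ 2 * (v ^ 2 * ∑ r, (lam r)⁻¹)) / (lam p + lam q)
      ≤ (NormedSpace.exp (conjDiag U d) - 1) p q := by
  have hlast := exp_sub_one_sub_le hU hJ p q
  have hZ : ∀ p q, 0 ≤ (NormedSpace.exp (conjDiag U d) - 1) p q := fun p q =>
    (hJ p q).trans (le_exp_sub_one hU hJ p q)
  set Z := NormedSpace.exp (conjDiag U d) - 1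
  -- Cancelling λ_p^{1/2} λ_q^{1/2} leaves an equation whose right side is constant. Both terms on
  -- the left are nonnegative, which is the source of the upper bound on Z.
  have hric' : ∀ p q, Z p q * (lam p + lam q) + ∑ r, lam r * Z p r * Z r q = 2 * v ^ 2 := by
    intro p q
    have hp := Real.sqrt_pos.mpr (hlam p)
    have hq := Real.sqrt_pos.mpr (hlam q)
    refine mul_left_cancel₀ (mul_pos hp hq).ne' ?_
    have h1 : ∑ r, √(lam p) * Z p r * √(lam r) * (√(lam r) * Z r q * √(lam q))
        = √(lam p) * √(lam q) * ∑ r, lam r * Z p r * Z r q := by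
      rw [Finset.mul_sum]
      refine Finset.sum_congr rfl fun r _ => ?_
      linear_combination (√(lam p) * √(lam q) * Z p r * Z r q) * Real.mul_self_sqrt (hlam r).le
    have h2 := hric p q
    rw [h1] at h2
    linear_combination h2
  have hup : ∀ p q, Z p q ≤ 2 * v ^ 2 / (lam p + lam q) := by
    intro p q
    rw [le_div_iff₀ (add_pos (hlam p) (hlam q))]
    have h1 : 0 ≤ ∑ r, lam r * Z p r * Z r q := Finset.sum_nonneg fun r _ =>
      mul_nonneg (mul_nonneg (hlam r).le (hZ p r)) (hZ r q)
    linarith [hric' p q]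
  have habs : ∀ p q, |Z p q| ≤ 2 * v ^ 2 / (lam p + lam q) := fun p q => by
    rw [abs_of_nonneg (hZ p q)]; exact hup p q
  have hv : 0 ≤ 2 * v ^ 2 := by positivity
  refine ⟨hup p q, ?_, ?_⟩
  · have h1 := (le_abs_self _).trans (mul_entry_le hlam hv habs habs p q)
    refine hlast.trans ?_
    have h3 : 2 * v ^ 2 * (2 * v ^ 2 * ∑ r, (lam r)⁻¹) / (lam p + lam q) / 2
        = 2 * v ^ 2 * (v ^ 2 * ∑ r, (lam r)⁻¹) / (lam p + lam q) := by ring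
    linarith
  · rw [div_le_iff₀ (add_pos (hlam p) (hlam q))]
    have h1 := (le_abs_self _).trans (mul_weight_mul_entry_le hlam hv habs habs p q)
    linarith [hric' p q]

omit [DecidableEq n] in
theorem sum_div_add_le {lam : n → ℝ} (hlam : ∀ p, 0 < lam p) {x : ℝ} (hx : 0 ≤ x) (p : n) :
    ∑ r, x / (lam p + lam r) ≤ x * ∑ r, (lam r)⁻¹ := by
  rw [Finset.mul_sum]
  refine Finset.sum_le_sum fun r _ => ?_
  rw [div_eq_mul_inv]
  have h1 := hlam p
  have h2 := hlam r
  exact mul_le_mul_of_nonneg_left (inv_anti₀ h2 (by linarith)) hx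

/-- `(1 + S) h (1 + S) ≈ h + t {K, h}`. -/
theorem one_add_mul_diagonal_mul_one_add {lam : n → ℝ} (hlam : ∀ p, 0 < lam p) {b g t : ℝ}
    (hb : 0 ≤ b) (hg : g = b * ∑ r, (lam r)⁻¹) {S K : Matrix n n ℝ}
    (hS : ∀ p q, |S p q| ≤ 2 * b / (lam p + lam q))
    (hSK : ∀ p q, |S p q - t * K p q| ≤ 2 * b * g / (lam p + lam q)) (p q : n) :
    |((1 + S) * Matrix.diagonal lam * (1 + S)) p q - Matrix.diagonal lam p q
      - t * (K p q * (lam p + lam q))| ≤ 6 * b * g := by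
  have h1 : ((1 + S) * Matrix.diagonal lam * (1 + S)) p q
      = Matrix.diagonal lam p q + S p q * (lam p + lam q) + ∑ r, lam r * S p r * S r q := by
    have h2 : (1 + S) * Matrix.diagonal lam * (1 + S)
        = Matrix.diagonal lam + S * Matrix.diagonal lam + Matrix.diagonal lam * S
          + S * Matrix.diagonal lam * S := by noncomm_ring
    rw [h2, Matrix.add_apply, Matrix.add_apply, Matrix.add_apply, Matrix.mul_diagonal,
      Matrix.diagonal_mul, Matrix.mul_apply]
    have h3 : ∀ r, (S * Matrix.diagonal lam) p r * S r q = lam r * S p r * S r q := fun r => by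
      rw [Matrix.mul_diagonal]; ring
    simp only [h3]
    ring
  have hpq := add_pos (hlam p) (hlam q)
  have h4 := mul_weight_mul_entry_le hlam (by positivity : 0 ≤ 2 * b) hS hS p q
  have h5 : |(S p q - t * K p q) * (lam p + lam q)| ≤ 2 * b * g := by
    rw [abs_mul, abs_of_pos hpq, ← le_div_iff₀ hpq]
    exact hSK p q
  have h6 : 2 * b * (2 * b * ∑ r, (lam r)⁻¹) = 4 * b * g := by rw [hg]; ring
  rw [h6] at h4
  rw [h1]
  have h7 : Matrix.diagonal lam p q + S p q * (lam p + lam q) + ∑ r, lam r * S p r * S r q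
      - Matrix.diagonal lam p q - t * (K p q * (lam p + lam q))
      = (S p q - t * K p q) * (lam p + lam q) + ∑ r, lam r * S p r * S r q := by ring
  rw [h7]
  exact (abs_add_le _ _).trans (by linarith)

/-- `(1 + S) P (1 + S) ≈ P` for a constant matrix `P`. -/
theorem one_add_mul_const_mul_one_add {lam : n → ℝ} (hlam : ∀ p, 0 < lam p) {v g : ℝ}
    (hg : g = v ^ 2 * ∑ r, (lam r)⁻¹) {S : Matrix n n ℝ}
    (hS : ∀ p q, |S p q| ≤ 2 * v ^ 2 / (lam p + lam q)) (p q : n) :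
    |((1 + S) * Matrix.vecMulVec (fun _ : n => v) (fun _ : n => v) * (1 + S)) p q - v ^ 2|
      ≤ 4 * v ^ 2 * g + 4 * v ^ 2 * g ^ 2 := by
  have h1 : ((1 + S) * Matrix.vecMulVec (fun _ : n => v) (fun _ : n => v) * (1 + S)) p q
      = v ^ 2 * (1 + ∑ r, S p r) * (1 + ∑ r, S r q) := by
    rw [Matrix.mul_vecMulVec, Matrix.vecMulVec_mul, Matrix.vecMulVec_apply]
    have h2 : (1 + S).mulVec (fun _ => v) p = v * (1 + ∑ r, S p r) := by
      simp only [Matrix.mulVec, dotProduct, Matrix.add_apply]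
      rw [← Finset.sum_mul, Finset.sum_add_distrib]
      simp [Matrix.one_apply, mul_comm]
    have h3 : Matrix.vecMul (fun _ => v) (1 + S) q = v * (1 + ∑ r, S r q) := by
      simp only [Matrix.vecMul, dotProduct, Matrix.add_apply]
      rw [← Finset.mul_sum, Finset.sum_add_distrib]
      simp [Matrix.one_apply]
    rw [h2, h3]
    ring
  have hv : 0 ≤ 2 * v ^ 2 := by positivity
  have hr : |∑ r, S p r| ≤ 2 * g := by
    refine (Finset.abs_sum_le_sum_abs _ _).trans ((Finset.sum_le_sum fun r _ => hS p r).trans ?_)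
    refine (sum_div_add_le hlam hv p).trans (le_of_eq ?_)
    rw [hg]; ring
  have hc : |∑ r, S r q| ≤ 2 * g := by
    refine (Finset.abs_sum_le_sum_abs _ _).trans ((Finset.sum_le_sum fun r _ => hS r q).trans ?_)
    simp only [add_comm _ (lam q)]
    refine (sum_div_add_le hlam hv q).trans (le_of_eq ?_)
    rw [hg]; ring
  rw [h1]
  set x := ∑ r, S p r
  set y := ∑ r, S r q
  have h2 : v ^ 2 * (1 + x) * (1 + y) - v ^ 2 = v ^ 2 * (x + y + x * y) := by ring
  have h3 : |x + y + x * y| ≤ 4 * g + 4 * g ^ 2 := by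
    have h4 : |x * y| ≤ 2 * g * (2 * g) := by
      rw [abs_mul]
      exact mul_le_mul hr hc (abs_nonneg _) ((abs_nonneg _).trans hr)
    refine (abs_add_le _ _).trans ?_
    have := abs_add_le x y
    nlinarith
  rw [h2, abs_mul, abs_of_nonneg (sq_nonneg v)]
  nlinarith [mul_le_mul_of_nonneg_left h3 (sq_nonneg v)]

end EntryBounds

/-! ### The logarithmic integral behind the trace formula -/

section LogIntegral

open Filter Topology

/-- An antiderivative of `log ((a² + t²) / (b² + t²))`. -/
noncomputable def logPrimitive (a b t : ℝ) : ℝ :=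
  t * (Real.log (a ^ 2 + t ^ 2) - Real.log (b ^ 2 + t ^ 2)) + 2 * a * Real.arctan (t / a)
    - 2 * b * Real.arctan (t / b)

theorem hasDerivAt_logPrimitive {a b : ℝ} (ha : 0 < a) (hb : 0 < b) (t : ℝ) :
    HasDerivAt (logPrimitive a b) (Real.log (a ^ 2 + t ^ 2) - Real.log (b ^ 2 + t ^ 2)) t := by
  have hl : ∀ c : ℝ, 0 < c →
      HasDerivAt (fun t : ℝ => Real.log (c ^ 2 + t ^ 2)) (2 * t / (c ^ 2 + t ^ 2)) t := by
    intro c hc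
    have h1 : HasDerivAt (fun t : ℝ => c ^ 2 + t ^ 2) (2 * t) t := by
      simpa using (hasDerivAt_pow 2 t).const_add (c ^ 2)
    exact h1.log (by positivity)
  have ht : ∀ c : ℝ, 0 < c →
      HasDerivAt (fun t : ℝ => 2 * c * Real.arctan (t / c)) (2 * c ^ 2 / (c ^ 2 + t ^ 2)) t := by
    intro c hc
    have h1 : HasDerivAt (fun t : ℝ => t / c) (1 / c) t := (hasDerivAt_id t).div_const c
    refine ((h1.arctan).const_mul (2 * c)).congr_deriv ?_
    have : c ^ 2 + t ^ 2 ≠ 0 := by positivity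
    have : 1 + (t / c) ^ 2 ≠ 0 := by positivity
    field_simp
  have h := (((hasDerivAt_id t).mul ((hl a ha).sub (hl b hb))).add (ht a ha)).sub (ht b hb)
  refine HasDerivAt.congr_deriv (f := logPrimitive a b) h ?_
  have h1 : a ^ 2 + t ^ 2 ≠ 0 := by positivity
  have h2 : b ^ 2 + t ^ 2 ≠ 0 := by positivity
  simp only [id, Pi.sub_apply]
  field_simp
  ring

/-- From log x ≤ x - 1 the expression is at most a²/t; exchanging a and b gives the lower bound
-b²/t. -/
theorem tendsto_mul_log_sub_log {a b : ℝ} (ha : 0 < a) (hb : 0 < b) :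
    Tendsto (fun t : ℝ => t * (Real.log (a ^ 2 + t ^ 2) - Real.log (b ^ 2 + t ^ 2))) atTop
      (𝓝 0) := by
  have hle : ∀ a b : ℝ, 0 < a → 0 < b → ∀ t : ℝ, 0 < t →
      t * (Real.log (a ^ 2 + t ^ 2) - Real.log (b ^ 2 + t ^ 2)) ≤ a ^ 2 / t := by
    intro a b ha hb t ht
    rw [← Real.log_div (by positivity) (by positivity)]
    have h1 := Real.log_le_sub_one_of_pos (x := (a ^ 2 + t ^ 2) / (b ^ 2 + t ^ 2)) (by positivity)
    have h2 : (a ^ 2 + t ^ 2) / (b ^ 2 + t ^ 2) - 1 ≤ a ^ 2 / t ^ 2 := by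
      rw [div_sub_one (by positivity), div_le_div_iff₀ (by positivity) (by positivity)]
      nlinarith [sq_nonneg (a * b), sq_nonneg (b * t), sq_nonneg (a * t)]
    calc _ ≤ t * (a ^ 2 / t ^ 2) := mul_le_mul_of_nonneg_left (h1.trans h2) ht.le
      _ = a ^ 2 / t := by field_simp
  have hd : ∀ c : ℝ, Tendsto (fun t : ℝ => c / t) atTop (𝓝 0) := fun c =>
    tendsto_const_nhds.div_atTop tendsto_id
  have hneg : Tendsto (fun t : ℝ => -(b ^ 2 / t)) atTop (𝓝 0) := by
    simpa using (hd (b ^ 2)).neg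
  refine tendsto_of_tendsto_of_tendsto_of_le_of_le' hneg (hd (a ^ 2)) ?_ ?_
  · filter_upwards [eventually_gt_atTop 0] with t ht
    have := hle b a hb ha t ht
    linarith
  · filter_upwards [eventually_gt_atTop 0] with t ht
    exact hle a b ha hb t ht

theorem tendsto_logPrimitive {a b : ℝ} (ha : 0 < a) (hb : 0 < b) :
    Tendsto (logPrimitive a b) atTop (𝓝 (Real.pi * (a - b))) := by
  have ht : ∀ c : ℝ, 0 < c →
      Tendsto (fun t : ℝ => 2 * c * Real.arctan (t / c)) atTop (𝓝 (2 * c * (Real.pi / 2))) := by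
    intro c hc
    refine Tendsto.const_mul _ ?_
    exact (tendsto_nhds_of_tendsto_nhdsWithin Real.tendsto_arctan_atTop).comp
      (tendsto_id.atTop_div_const hc)
  have h := ((tendsto_mul_log_sub_log ha hb).add (ht a ha)).sub (ht b hb)
  have he : Real.pi * (a - b) = 0 + 2 * a * (Real.pi / 2) - 2 * b * (Real.pi / 2) := by ring
  rw [he]
  exact h

theorem log_sub_log_integral {a b : ℝ} (ha : 0 < a) (hb : 0 < b) :
    MeasureTheory.IntegrableOn
      (fun t : ℝ => Real.log (a ^ 2 + t ^ 2) - Real.log (b ^ 2 + t ^ 2)) (Set.Ioi 0) ∧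
    ∫ t in Set.Ioi (0 : ℝ), (Real.log (a ^ 2 + t ^ 2) - Real.log (b ^ 2 + t ^ 2))
      = Real.pi * (a - b) := by
  have h0 : logPrimitive a b 0 = 0 := by simp [logPrimitive]
  -- The integrand has a constant sign, determined by the order of a and b. Integrability then
  -- follows from the limit of the antiderivative alone.
  rcases le_total b a with hab | hab
  · have hpos : ∀ t ∈ Set.Ioi (0 : ℝ), 0 ≤ Real.log (a ^ 2 + t ^ 2) - Real.log (b ^ 2 + t ^ 2) := by
      intro t _
      rw [sub_nonneg]
      exact Real.log_le_log (by positivity) (by nlinarith)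
    refine ⟨MeasureTheory.integrableOn_Ioi_deriv_of_nonneg'
      (fun t _ => hasDerivAt_logPrimitive ha hb t) hpos (tendsto_logPrimitive ha hb), ?_⟩
    rw [MeasureTheory.integral_Ioi_of_hasDerivAt_of_nonneg'
      (fun t _ => hasDerivAt_logPrimitive ha hb t) hpos (tendsto_logPrimitive ha hb), h0, sub_zero]
  · have hneg : ∀ t ∈ Set.Ioi (0 : ℝ), Real.log (a ^ 2 + t ^ 2) - Real.log (b ^ 2 + t ^ 2) ≤ 0 := by
      intro t _
      rw [sub_nonpos]
      exact Real.log_le_log (by positivity) (by nlinarith)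
    refine ⟨MeasureTheory.integrableOn_Ioi_deriv_of_nonpos'
      (fun t _ => hasDerivAt_logPrimitive ha hb t) hneg (tendsto_logPrimitive ha hb), ?_⟩
    rw [MeasureTheory.integral_Ioi_of_hasDerivAt_of_nonpos'
      (fun t _ => hasDerivAt_logPrimitive ha hb t) hneg (tendsto_logPrimitive ha hb), h0, sub_zero]

/-- The trace formula in scalar form. -/
theorem integral_F_resolventForm {n : Type*} [Fintype n] {lam : n → ℝ} (hlam : ∀ p, 0 < lam p)
    {c : ℝ} (hc : 0 ≤ c) {m : n → ℝ} (hm : ∀ i, 0 < m i)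
    (hprod : ∀ t : ℝ, ∏ i, (m i + t ^ 2)
        = (∏ p, (lam p ^ 2 + t ^ 2)) * (1 + 2 * resolventForm lam c t)) :
    MeasureTheory.IntegrableOn (fun t : ℝ => F (2 * resolventForm lam c t)) (Set.Ioi 0) ∧
    ∫ t in Set.Ioi (0 : ℝ), F (2 * resolventForm lam c t)
      = Real.pi * ∑ i, (√(m i) - lam i - c) := by
  have hs : ∀ i, 0 < √(m i) := fun i => Real.sqrt_pos.mpr (hm i)
  -- The logarithm of the product formula splits F into finitely many integrable pieces. Pairing m_i
  -- with λ_i is arbitrary, since only the sums matter. The subtracted linear term integrates to πc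
  -- for each index, which becomes π tr P.
  have hF : (fun t : ℝ => F (2 * resolventForm lam c t))
      = fun t : ℝ => ∑ i, ((Real.log (√(m i) ^ 2 + t ^ 2) - Real.log (lam i ^ 2 + t ^ 2))
          - 2 * c * lam i * (lam i ^ 2 + t ^ 2)⁻¹) := by
    ext t
    have h1 := resolventForm_nonneg hlam hc t
    have h2 : ∀ i, lam i ^ 2 + t ^ 2 ≠ 0 := fun i => by have := hlam i; positivity
    have h3 : ∀ i, m i + t ^ 2 ≠ 0 := fun i => by have := hm i; positivity
    have h4 := congrArg Real.log (hprod t)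
    rw [Real.log_mul (Finset.prod_ne_zero_iff.mpr fun i _ => h2 i) (by positivity),
      Real.log_prod fun i _ => h2 i, Real.log_prod fun i _ => h3 i] at h4
    have h5 : ∀ i, √(m i) ^ 2 = m i := fun i => Real.sq_sqrt (hm i).le
    simp only [h5, Finset.sum_sub_distrib]
    rw [F, h4, resolventForm, Finset.mul_sum, Finset.mul_sum]
    have h6 : ∑ i, 2 * (c * (lam i / (lam i ^ 2 + t ^ 2)))
        = ∑ i, 2 * c * lam i * (lam i ^ 2 + t ^ 2)⁻¹ :=
      Finset.sum_congr rfl fun i _ => by ring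
    rw [h6]
    ring
  have hi : ∀ i, MeasureTheory.IntegrableOn (fun t : ℝ =>
      (Real.log (√(m i) ^ 2 + t ^ 2) - Real.log (lam i ^ 2 + t ^ 2))
          - 2 * c * lam i * (lam i ^ 2 + t ^ 2)⁻¹) (Set.Ioi 0) := fun i =>
    (log_sub_log_integral (hs i) (hlam i)).1.sub
      ((integrableOn_inv_sq_add_sq (hlam i)).const_mul _)
  rw [hF]
  refine ⟨MeasureTheory.integrable_finsetSum _ fun i _ => hi i, ?_⟩
  rw [MeasureTheory.integral_finsetSum _ fun i _ => hi i, Finset.mul_sum]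
  refine Finset.sum_congr rfl fun i _ => ?_
  rw [MeasureTheory.integral_sub (log_sub_log_integral (hs i) (hlam i)).1
    ((integrableOn_inv_sq_add_sq (hlam i)).const_mul _), (log_sub_log_integral (hs i) (hlam i)).2,
    MeasureTheory.integral_const_mul, integral_inv_sq_add_sq (hlam i)]
  have := hlam i
  field_simp

end LogIntegral

/-! ### The trace formula and the entry bounds for K, A and B -/

section Operators

theorem lam_pos {kF : ℝ} {k : Fin 3 → ℤ} (p : lune kF k) : 0 < lam k p := by
  have h1 := p.2.1
  have h2 := p.2.2
  have h3 : 0 ≤ latticeNorm ((p : Fin 3 → ℤ) - k) := Real.sqrt_nonneg _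
  have : latticeNorm ((p : Fin 3 → ℤ) - k) ^ 2 < latticeNorm p ^ 2 := by gcongr; linarith
  rw [lam]
  linarith

/-- The square of the constant entries of `v_k`. -/
noncomputable def coupling (s : ℕ) (V : (Fin 3 → ℤ) → ℝ) (kF : ℝ) (k : Fin 3 → ℤ) : ℝ :=
  s * V k * kF⁻¹ / (2 * (2 * Real.pi) ^ 3)

variable {s : ℕ} {V : (Fin 3 → ℤ) → ℝ} {kF : ℝ} {k : Fin 3 → ℤ}

theorem coupling_nonneg (hV : 0 ≤ V k) (hkF : 0 < kF) : 0 ≤ coupling s V kF k := by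
  unfold coupling; positivity

/-- The spectral data behind `K_k`. -/
theorem exists_K_structure (s : ℕ) (hV : 0 ≤ V k) (hkF : 0 < kF) :
    ∃ (U : Op kF k) (d m : lune kF k → ℝ), U.transpose * U = 1 ∧
      (∀ p q, 0 ≤ conjDiag U d p q) ∧
      K s V kF k = (-(1 / 2) : ℝ) • conjDiag U d ∧
      (∀ p q : lune kF k, √(lam k p) * (NormedSpace.exp (conjDiag U d) - 1) p q * √(lam k q) *
          (lam k p + lam k q)
        + ∑ r : lune kF k, (√(lam k p) * (NormedSpace.exp (conjDiag U d) - 1) p r * √(lam k r)) *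
            (√(lam k r) * (NormedSpace.exp (conjDiag U d) - 1) r q * √(lam k q))
        = 2 * coupling s V kF k * √(lam k p) * √(lam k q)) ∧
      (∀ i, 0 < m i) ∧
      ∑ p : lune kF k, lam k p * NormedSpace.exp (conjDiag U d) p p = ∑ i, √(m i) ∧
      ∀ t : ℝ, ∏ i, (m i + t ^ 2) = (∏ p : lune kF k, (lam k p ^ 2 + t ^ 2)) *
        (1 + 2 * resolventForm (fun p : lune kF k => lam k p) (coupling s V kF k) t) := by
  obtain ⟨U, d, m, h1, h2, h3, h4, h5, h6, h7⟩ :=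
    exists_log_structure (lam := fun p : lune kF k => lam k p) lam_pos √(coupling s V kF k)
  rw [Real.sq_sqrt (coupling_nonneg hV hkF)] at h4 h7
  refine ⟨U, d, m, h1, h2, ?_, h4, h5, h6, h7⟩
  rw [← h3]
  rfl

/-- Cyclicity of the trace reduces e^{-K} h e^{-K} to h e^{-2K} = h e^J, whose trace is ∑ √m_i; the
traces of h and P are ∑ λ_p and ∑ b. -/
theorem trace_formula (s : ℕ) (hV : 0 ≤ V k) (hkF : 0 < kF) :
    MeasureTheory.IntegrableOn (fun t : ℝ => F (bosonicArg s V kF k t)) (Set.Ioi 0) ∧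
    Matrix.trace (expK s V kF k (-1) * h kF k * expK s V kF k (-1) - h kF k - P s V kF k)
      = 1 / Real.pi * ∫ t in Set.Ioi (0 : ℝ), F (bosonicArg s V kF k t) := by
  obtain ⟨U, d, m, hU, -, hK, -, hm, htr, hprod⟩ := exists_K_structure (V := V) (k := k) s hV hkF
  have hc := coupling_nonneg (s := s) hV hkF
  have harg : (fun t : ℝ => F (bosonicArg s V kF k t)) = fun t =>
      F (2 * resolventForm (fun p : lune kF k => lam k p) (coupling s V kF k) t) := by
    ext t
    congr 1
    rw [bosonicArg, resolventForm, coupling, ← mul_assoc]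
    congr 1
    field_simp
  obtain ⟨hint, hval⟩ := integral_F_resolventForm (lam := fun p : lune kF k => lam k p) lam_pos hc
    hm hprod
  rw [harg]
  refine ⟨hint, ?_⟩
  rw [hval, ← mul_assoc, one_div_mul_cancel Real.pi_ne_zero, one_mul]
  have hexp : expK s V kF k (-1) * expK s V kF k (-1) = NormedSpace.exp (conjDiag U d) := by
    rw [expK, hK, smul_smul, conjDiag_smul, exp_conjDiag hU, exp_conjDiag hU, conjDiag_mul hU]
    congr 1
    ext i
    simp only [Pi.mul_apply, Pi.smul_apply, smul_eq_mul, ← Real.exp_add]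
    congr 1
    ring
  have hP : Matrix.trace (P s V kF k) = ∑ _i : lune kF k, coupling s V kF k := by
    rw [Matrix.trace]
    refine Finset.sum_congr rfl fun p _ => ?_
    rw [Matrix.diag_apply, P, Matrix.vecMulVec_apply]
    exact Real.mul_self_sqrt hc
  rw [Matrix.trace_sub, Matrix.trace_sub, Matrix.trace_mul_cycle, hexp, hP, h,
    Matrix.trace_diagonal, Finset.sum_sub_distrib, Finset.sum_sub_distrib, ← htr]
  congr 2
  rw [Matrix.trace]
  refine Finset.sum_congr rfl fun p _ => ?_
  rw [Matrix.diag_apply, Matrix.mul_diagonal, mul_comm]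

/-- All entrywise bounds in terms of the coupling `b` and `g = b ∑ λ⁻¹`. -/
theorem operator_bounds (s : ℕ) (hV : 0 ≤ V k) (hkF : 0 < kF) {b g : ℝ}
    (hb : b = coupling s V kF k) (hg : g = b * ∑ r : lune kF k, (lam k r)⁻¹) :
    (∀ p q : lune kF k, |K s V kF k p q| ≤ b / (lam k p + lam k q)) ∧
    (∀ p q : lune kF k, |(-K s V kF k) p q - b / (lam k p + lam k q)|
      ≤ 3 * b * g / (lam k p + lam k q)) ∧
    (∀ p q : lune kF k, ∀ t ∈ Set.Icc (0 : ℝ) 1,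
      |A s V kF k t p q| ≤ b + 10 * b * g + 4 * b * g ^ 2 ∧
      |B s V kF k t p q - b * (1 - t)| ≤ 13 * b * g + 4 * b * g ^ 2) ∧
    (∀ p q : lune kF k, Continuous fun t => B s V kF k t p q) := by
  obtain ⟨U, d, m, hU, hJ, hK, hric, -, -, -⟩ := exists_K_structure (V := V) (k := k) s hV hkF
  have hb0 : 0 ≤ b := hb ▸ coupling_nonneg hV hkF
  have hg0 : 0 ≤ g := by
    rw [hg]
    exact mul_nonneg hb0 (Finset.sum_nonneg fun r _ => (inv_pos.mpr (lam_pos r)).le)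
  have hlam : ∀ p : lune kF k, 0 < (fun p : lune kF k => lam k p) p := lam_pos
  have hb2 : √b ^ 2 = b := Real.sq_sqrt hb0
  have hbd := log_entry_bounds (v := √b) hlam hU hJ (by rw [hb2, hb]; exact hric)
  rw [hb2, ← hg] at hbd
  have hadd : ∀ p q : lune kF k, 0 < lam k p + lam k q := fun p q =>
    add_pos (lam_pos p) (lam_pos q)
  have hKpq : ∀ p q, K s V kF k p q = -(1 / 2) * conjDiag U d p q := fun p q => by
    rw [hK, Matrix.smul_apply, smul_eq_mul]
  have h1 : ∀ p q : lune kF k, |K s V kF k p q| ≤ b / (lam k p + lam k q) := by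
    intro p q
    have e1 := (hbd p q).1
    have e2 := le_exp_sub_one hU hJ p q
    rw [hKpq, abs_mul, abs_of_nonneg (hJ p q), abs_neg, abs_of_pos (by norm_num)]
    have e3 : 2 * b / (lam k p + lam k q) = 2 * (b / (lam k p + lam k q)) := by ring
    linarith
  -- Here -K = J/2 and, in units of 1/(λ_p + λ_q), 2b - 6bg ≤ J ≤ 2b: the lower bound on Z loses 4bg
  -- and the passage from Z to J another 2bg.
  have h2 : ∀ p q : lune kF k, |(-K s V kF k) p q - b / (lam k p + lam k q)|
      ≤ 3 * b * g / (lam k p + lam k q) := by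
    intro p q
    obtain ⟨e1, e2, e3⟩ := hbd p q
    have e4 := le_exp_sub_one hU hJ p q
    rw [Matrix.neg_apply, hKpq]
    have e5 : 2 * b / (lam k p + lam k q) = 2 * (b / (lam k p + lam k q)) := by ring
    have e6 : (2 * b - 4 * b * g) / (lam k p + lam k q)
      = 2 * (b / (lam k p + lam k q)) - 4 * (b * g / (lam k p + lam k q)) := by ring
    have e7 : 2 * b * g / (lam k p + lam k q) = 2 * (b * g / (lam k p + lam k q)) := by ring
    have e8 : 3 * b * g / (lam k p + lam k q) = 3 * (b * g / (lam k p + lam k q)) := by ring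
    have e9 : 0 ≤ b * g / (lam k p + lam k q) := div_nonneg (mul_nonneg hb0 hg0) (hadd p q).le
    rw [e5] at e1
    rw [e7] at e2
    rw [e6] at e3
    rw [e8, abs_le]
    constructor <;> linarith
  -- Since tK = -(t/2)J, the power series of e^{tK} - 1 and of e^{tK} - 1 - tK are dominated
  -- entrywise by those of e^J - 1 and e^J - 1 - J, whatever the sign of t.
  have hS : ∀ t : ℝ, |t| ≤ 1 → ∀ p q : lune kF k,
      |(expK s V kF k t - 1) p q| ≤ 2 * b / (lam k p + lam k q) ∧
      |(expK s V kF k t - 1) p q - t * K s V kF k p q| ≤ 2 * b * g / (lam k p + lam k q) := by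
    intro t ht p q
    have e0 : expK s V kF k t = NormedSpace.exp ((-(t / 2)) • conjDiag U d) := by
      rw [expK, hK, smul_smul]
      congr 2
      ring
    have ht' : |-(t / 2)| ≤ 1 := by
      rw [abs_neg, abs_div, abs_of_pos (by norm_num : (0 : ℝ) < 2)]
      linarith
    have e1 := abs_exp_sub_one_le hU hJ ht' p q
    have e2 := abs_exp_sub_one_sub_le hU hJ ht' p q
    obtain ⟨e3, e4, -⟩ := hbd p q
    rw [e0, Matrix.sub_apply, hKpq]
    rw [Matrix.sub_apply] at e3 e4
    refine ⟨e1.trans e3, ?_⟩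
    have e5 : t * (-(1 / 2) * conjDiag U d p q) = -(t / 2) * conjDiag U d p q := by ring
    rw [e5]
    exact e2.trans e4
  have hT : ∀ t : ℝ, |t| ≤ 1 → ∀ p q : lune kF k,
      |(expK s V kF k t * h kF k * expK s V kF k t) p q - h kF k p q
        - t * (K s V kF k p q * (lam k p + lam k q))| ≤ 6 * b * g := by
    intro t ht p q
    have e1 := one_add_mul_diagonal_mul_one_add hlam hb0 hg (S := expK s V kF k t - 1)
      (K := K s V kF k) (fun p q => (hS t ht p q).1) (fun p q => (hS t ht p q).2) p q
    rwa [add_sub_cancel] at e1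
  have hQ : ∀ t : ℝ, |t| ≤ 1 → ∀ p q : lune kF k,
      |(expK s V kF k t * P s V kF k * expK s V kF k t) p q - b| ≤ 4 * b * g + 4 * b * g ^ 2 := by
    intro t ht p q
    have e1 := one_add_mul_const_mul_one_add (v := √b) (g := g) hlam (by rw [hb2]; exact hg)
      (S := expK s V kF k t - 1) (by rw [hb2]; exact fun p q => (hS t ht p q).1) p q
    rw [add_sub_cancel, hb2, hb] at e1
    rw [hb]
    exact e1
  have hKh : ∀ p q : lune kF k, |K s V kF k p q * (lam k p + lam k q) + b| ≤ 3 * b * g := by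
    intro p q
    have e1 := h2 p q
    have e2 := hadd p q
    rw [le_div_iff₀ e2, ← abs_of_pos e2, ← abs_mul, abs_of_pos e2, sub_mul,
      div_mul_cancel₀ _ e2.ne', Matrix.neg_apply] at e1
    rw [← abs_neg]
    have e3 : -(K s V kF k p q * (lam k p + lam k q) + b)
        = -K s V kF k p q * (lam k p + lam k q) - b := by ring
    rw [e3]
    exact e1
  have hsplit : ∀ t : ℝ, expK s V kF k t * (h kF k + (2 : ℝ) • P s V kF k) * expK s V kF k t
      = expK s V kF k t * h kF k * expK s V kF k t
        + (2 : ℝ) • (expK s V kF k t * P s V kF k * expK s V kF k t) := by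
    intro t
    rw [Matrix.mul_add, Matrix.add_mul, Matrix.mul_smul, Matrix.smul_mul]
  refine ⟨h1, h2, ?_, ?_⟩
  · intro p q t ht
    have ht1 : |t| ≤ 1 := by rw [abs_of_nonneg ht.1]; exact ht.2
    have ht2 : |-t| ≤ 1 := by rwa [abs_neg]
    have e1 := abs_le.mp (hT t ht1 p q)
    have e2 := abs_le.mp (hT (-t) ht2 p q)
    have e3 := abs_le.mp (hQ t ht1 p q)
    have e4 := abs_le.mp (hKh p q)
    set y := K s V kF k p q * (lam k p + lam k q) with hy
    have hbg : 0 ≤ b * g := mul_nonneg hb0 hg0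
    have e5 : |t * (y + b)| ≤ 3 * b * g := by
      rw [abs_mul]
      calc |t| * |y + b| ≤ 1 * (3 * b * g) :=
            mul_le_mul ht1 (hKh p q) (abs_nonneg _) zero_le_one
        _ = _ := one_mul _
    have e6 := abs_le.mp e5
    constructor
    -- The linear terms ty and -ty cancel, so A ≈ b. The error is (6 + 2·4 + 6)/2 = 10 times bg,
    -- plus 4bg².
    · have hA : A s V kF k t p q = (1 / 2) * ((expK s V kF k t * h kF k * expK s V kF k t) p q
          + 2 * (expK s V kF k t * P s V kF k * expK s V kF k t) p q
          + (expK s V kF k (-t) * h kF k * expK s V kF k (-t)) p q) - h kF k p q := by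
        rw [A, hsplit]
        simp only [Matrix.sub_apply, Matrix.smul_apply, Matrix.add_apply, smul_eq_mul]
      rw [hA, abs_le]
      constructor <;> linarith [e1.1, e1.2, e2.1, e2.2, e3.1, e3.2]
    -- The linear terms now add, so B ≈ b + ty. Replacing y by -b costs 3bg beyond the 10bg + 4bg²
    -- already present for A.
    · have hB : B s V kF k t p q = (1 / 2) * ((expK s V kF k t * h kF k * expK s V kF k t) p q
          + 2 * (expK s V kF k t * P s V kF k * expK s V kF k t) p q
          - (expK s V kF k (-t) * h kF k * expK s V kF k (-t)) p q) := by
        rw [B, hsplit]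
        simp only [Matrix.sub_apply, Matrix.smul_apply, Matrix.add_apply, smul_eq_mul]
      rw [hB, abs_le]
      constructor <;> linarith [e1.1, e1.2, e2.1, e2.2, e3.1, e3.2, e6.1, e6.2]
  · intro p q
    have hc : Continuous fun t => expK s V kF k t := by
      have e0 : (fun t => expK s V kF k t)
          = fun t : ℝ => conjDiag U (fun i => Real.exp (t * (-(1 / 2) * d i))) := by
        ext1 t
        rw [expK, hK, conjDiag_smul, conjDiag_smul, exp_conjDiag hU]
        rfl
      rw [e0]
      refine continuous_matrix fun i j => ?_
      simp only [conjDiag_apply]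
      fun_prop
    have hc' : Continuous fun t => expK s V kF k (-t) := hc.comp continuous_neg
    have c1 : Continuous fun t => (expK s V kF k t * (h kF k + (2 : ℝ) • P s V kF k)
        * expK s V kF k t) p q :=
      ((hc.matrix_mul continuous_const).matrix_mul hc).matrix_elem p q
    have c2 : Continuous fun t => (expK s V kF k (-t) * h kF k * expK s V kF k (-t)) p q :=
      ((hc'.matrix_mul continuous_const).matrix_mul hc').matrix_elem p q
    exact continuous_const.mul (c1.sub c2)

end Operators

/-! ### From b and g to the stated powers of the potential and the Fermi momentum -/

section Assembly

variable {s : ℕ} {V : (Fin 3 → ℤ) → ℝ} {kF : ℝ} {k : Fin 3 → ℤ}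

/-- A matrix with entries at most `b / (λ_p + λ_q)` has Hilbert–Schmidt norm at most `b ∑ λ⁻¹`. -/
theorem hsNorm_le_of_entry_le {T : Op kF k} {b : ℝ} (hb : 0 ≤ b)
    (hT : ∀ p q : lune kF k, |T p q| ≤ b / (lam k p + lam k q)) :
    hsNorm T ≤ b * ∑ r : lune kF k, (lam k r)⁻¹ := by
  have h0 : 0 ≤ ∑ r : lune kF k, (lam k r)⁻¹ :=
    Finset.sum_nonneg fun r _ => (inv_pos.mpr (lam_pos r)).le
  refine Real.sqrt_le_iff.mpr ⟨mul_nonneg hb h0, ?_⟩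
  rw [mul_pow, sq (∑ r : lune kF k, (lam k r)⁻¹), Finset.sum_mul_sum, Finset.mul_sum]
  refine Finset.sum_le_sum fun p _ => ?_
  rw [Finset.mul_sum]
  refine Finset.sum_le_sum fun q _ => ?_
  have hp := lam_pos p
  have hq := lam_pos q
  calc |T p q| ^ 2 ≤ (b / (lam k p + lam k q)) ^ 2 := by gcongr; exact hT p q
    _ = b ^ 2 * ((lam k p + lam k q) ^ 2)⁻¹ := by rw [div_pow, div_eq_mul_inv]
    _ ≤ b ^ 2 * (lam k p * lam k q)⁻¹ := by gcongr; nlinarith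
    _ = b ^ 2 * ((lam k p)⁻¹ * (lam k q)⁻¹) := by rw [mul_inv]

/-- Rows and columns of S have absolute sums at most b ∑ λ⁻¹. For S = K this factor is of order
V̂_k, which accounts for the extra power in the anticommutator bound. -/
theorem anticomm_entry_le {S T : Op kF k} {b β : ℝ} (hb : 0 ≤ b)
    (hS : ∀ p q : lune kF k, |S p q| ≤ b / (lam k p + lam k q)) (hT : ∀ p q, |T p q| ≤ β)
    (p q : lune kF k) : |anticomm S T p q| ≤ 2 * (b * ∑ r : lune kF k, (lam k r)⁻¹) * β := by
  have hβ : 0 ≤ β := (abs_nonneg _).trans (hT p q)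
  have hlam : ∀ p : lune kF k, 0 < (fun p : lune kF k => lam k p) p := lam_pos
  have h1 : |(S * T) p q| ≤ (b * ∑ r : lune kF k, (lam k r)⁻¹) * β := by
    rw [Matrix.mul_apply]
    refine (Finset.abs_sum_le_sum_abs _ _).trans ?_
    refine le_trans ?_ (mul_le_mul_of_nonneg_right (sum_div_add_le hlam hb p) hβ)
    rw [Finset.sum_mul]
    refine Finset.sum_le_sum fun r _ => ?_
    rw [abs_mul]
    exact mul_le_mul (hS p r) (hT r q) (abs_nonneg _) ((abs_nonneg _).trans (hS p r))
  have h2 : |(T * S) p q| ≤ (b * ∑ r : lune kF k, (lam k r)⁻¹) * β := by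
    rw [Matrix.mul_apply]
    refine (Finset.abs_sum_le_sum_abs _ _).trans ?_
    refine le_trans ?_ (mul_le_mul_of_nonneg_right (sum_div_add_le hlam hb q) hβ)
    rw [Finset.sum_mul]
    refine Finset.sum_le_sum fun r _ => ?_
    rw [abs_mul, mul_comm]
    have h3 := hS r q
    rw [add_comm] at h3
    exact mul_le_mul h3 (hT p r) (abs_nonneg _) ((abs_nonneg _).trans h3)
  rw [anticomm, Matrix.add_apply]
  exact (abs_add_le _ _).trans (by linarith)

/-- The model b(1 - t) has mean b/2 on the unit interval, and a uniform error passes through the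
integral unchanged. -/
theorem abs_intB_sub_le {b ε : ℝ} {p q : lune kF k}
    (hc : Continuous fun t => B s V kF k t p q)
    (hB : ∀ t ∈ Set.Icc (0 : ℝ) 1, |B s V kF k t p q - b * (1 - t)| ≤ ε) :
    |intB s V kF k p q - b / 2| ≤ ε := by
  have h1 : ∫ t in (0 : ℝ)..1, b * (1 - t) = b / 2 := by
    rw [intervalIntegral.integral_const_mul, intervalIntegral.integral_sub
      intervalIntegrable_const intervalIntegral.intervalIntegrable_id,
      intervalIntegral.integral_const, integral_id]
    norm_num
    ring
  have hc' : Continuous fun t : ℝ => b * (1 - t) := by fun_prop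
  have h2 : intB s V kF k p q - b / 2 = ∫ t in (0 : ℝ)..1, (B s V kF k t p q - b * (1 - t)) := by
    rw [intervalIntegral.integral_sub (hc.intervalIntegrable 0 1)
      (hc'.intervalIntegrable 0 1), ← h1]
    rfl
  rw [h2, ← Real.norm_eq_abs]
  have h3 := intervalIntegral.norm_integral_le_of_norm_le_const (a := (0 : ℝ)) (b := 1) (C := ε)
    (f := fun t => B s V kF k t p q - b * (1 - t)) (fun t ht => by
      rw [Set.uIoc_of_le zero_le_one] at ht
      exact hB t ⟨ht.1.le, ht.2⟩)
  simpa using h3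

/-- The scalar inequalities that turn bounds in `b`, `g` into bounds in `x = V̂_k`, `y = k_F⁻¹`. -/
theorem scalar_bounds {D E x y b g : ℝ} (hD : 0 < D) (hE : 0 < E) (hx : 0 ≤ x) (hy : 0 < y)
    (hb : b = D * x * y) (hg0 : 0 ≤ g) (hg : g ≤ E * x) :
    3 * b * g ≤ 3 * D * E * (x ^ 2 * y) ∧
    b + 13 * b * g + 4 * b * g ^ 2 ≤ D * (1 + 13 * E + 4 * E ^ 2) * (1 + x ^ 2) * x * y ∧
    13 * b * g + 4 * b * g ^ 2 ≤ D * (1 + 13 * E + 4 * E ^ 2) * (1 + x) * x ^ 2 * y := by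
  have hDxy : 0 ≤ D * x * y := by positivity
  have hbg : b * g ≤ D * x * y * (E * x) := by
    rw [hb]; exact mul_le_mul_of_nonneg_left hg hDxy
  have hbg2 : b * g ^ 2 ≤ D * x * y * (E * x) ^ 2 := by
    rw [hb]; exact mul_le_mul_of_nonneg_left (pow_le_pow_left₀ hg0 hg 2) hDxy
  have hx1 : x ≤ 1 + x ^ 2 := by nlinarith [sq_nonneg (x - 1)]
  refine ⟨by linarith, ?_, ?_⟩
  · calc b + 13 * b * g + 4 * b * g ^ 2
        ≤ D * x * y * (1 + 13 * (E * x) + 4 * (E * x) ^ 2) := by linarith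
      _ ≤ D * x * y * ((1 + 13 * E + 4 * E ^ 2) * (1 + x ^ 2)) := by
          refine mul_le_mul_of_nonneg_left ?_ hDxy
          nlinarith [sq_nonneg x, mul_le_mul_of_nonneg_left hx1 hE.le, sq_nonneg E]
      _ = _ := by ring
  · calc 13 * b * g + 4 * b * g ^ 2
        ≤ D * x ^ 2 * y * (13 * E + 4 * E ^ 2 * x) := by linarith
      _ ≤ D * x ^ 2 * y * ((1 + 13 * E + 4 * E ^ 2) * (1 + x)) := by
          refine mul_le_mul_of_nonneg_left ?_ (by positivity)
          nlinarith [mul_nonneg hE.le hx, mul_nonneg (sq_nonneg E) hx, sq_nonneg E]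
      _ = _ := by ring

theorem entry_estimates (hV : 0 ≤ V k) (hkF : 0 < kF) {D E G b : ℝ} (hD : 0 < D) (hE : 0 < E)
    (hG : G = D * (1 + 13 * E + 4 * E ^ 2))
    (hb : b = coupling s V kF k) (hbD : b = D * V k * kF⁻¹)
    (hgE : b * ∑ r : lune kF k, (lam k r)⁻¹ ≤ E * V k) (p q : lune kF k) :
    |K s V kF k p q| ≤ D * (V k * kF⁻¹ / (lam k p + lam k q)) ∧
    |(-K s V kF k) p q - b * (1 / (lam k p + lam k q))|
        ≤ 3 * D * E * (V k ^ 2 * kF⁻¹ / (lam k p + lam k q)) ∧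
    (∀ t ∈ Set.Icc (0 : ℝ) 1,
      |A s V kF k t p q| ≤ G * (1 + V k ^ 2) * V k * kF⁻¹ ∧
      |B s V kF k t p q| ≤ G * (1 + V k ^ 2) * V k * kF⁻¹ ∧
      |anticomm (K s V kF k) (B s V kF k t) p q| ≤ 2 * E * G * (1 + V k ^ 2) * V k ^ 2 * kF⁻¹) ∧
    IntervalIntegrable (fun t : ℝ => B s V kF k t p q) MeasureTheory.volume 0 1 ∧
    |intB s V kF k p q - b / 2| ≤ G * (1 + V k) * V k ^ 2 * kF⁻¹ := by
  obtain ⟨h1, h2, h3, h4⟩ := operator_bounds (k := k) s hV hkF hb rfl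
  have hb0 : 0 ≤ b := hb ▸ coupling_nonneg hV hkF
  have hg0 : 0 ≤ b * ∑ r : lune kF k, (lam k r)⁻¹ :=
    mul_nonneg hb0 (Finset.sum_nonneg fun r _ => (inv_pos.mpr (lam_pos r)).le)
  obtain ⟨s1, s2, s3⟩ := scalar_bounds hD hE hV (inv_pos.mpr hkF) hbD hg0 hgE
  rw [← hG] at s2 s3
  have hG0 : 0 ≤ G := by rw [hG]; positivity
  have hpq := add_pos (lam_pos p) (lam_pos q)
  have hB : ∀ t ∈ Set.Icc (0 : ℝ) 1, ∀ p q : lune kF k,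
      |B s V kF k t p q| ≤ G * (1 + V k ^ 2) * V k * kF⁻¹ := by
    intro t ht p q
    refine le_trans ?_ s2
    have e1 := abs_le.mp (h3 p q t ht).2
    have e2 : 0 ≤ b * (1 - t) := mul_nonneg hb0 (by linarith [ht.2])
    have e3 : b * (1 - t) ≤ b := mul_le_of_le_one_right hb0 (by linarith [ht.1])
    rw [abs_le]
    constructor <;> linarith [e1.1, e1.2]
  refine ⟨?_, ?_, fun t ht => ⟨?_, hB t ht p q, ?_⟩, (h4 p q).intervalIntegrable 0 1, ?_⟩
  · refine (h1 p q).trans (le_of_eq ?_)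
    rw [hbD]; ring
  · rw [mul_one_div, ← mul_div_assoc]
    exact (h2 p q).trans (div_le_div_of_nonneg_right s1 hpq.le)
  · refine (h3 p q t ht).1.trans (le_trans ?_ s2)
    have e1 := mul_nonneg hb0 hg0
    linarith
  · refine (anticomm_entry_le hb0 h1 (hB t ht) p q).trans ?_
    have e1 : 0 ≤ G * (1 + V k ^ 2) * V k * kF⁻¹ := (abs_nonneg _).trans (hB t ht p q)
    calc _ ≤ 2 * (E * V k) * (G * (1 + V k ^ 2) * V k * kF⁻¹) := by gcongr
      _ = _ := by ring
  · exact (abs_intB_sub_le (h4 p q) fun t ht => (h3 p q t ht).2).trans s3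

/-- The estimates follow from a bound on `∑ λ⁻¹`. -/
theorem estimates_of_sum_bound {C₁ : ℝ} (hC₁ : 0 < C₁) (hs : 1 ≤ s) :
    ∃ C : ℝ, 0 < C ∧ ∀ (kF : ℝ), 0 < kF → ∀ (V : (Fin 3 → ℤ) → ℝ) (k : Fin 3 → ℤ), 0 ≤ V k →
      (∑ r : lune kF k, (lam k r)⁻¹ ≤ C₁ * kF * min 1 (kF ^ 2 / latticeNorm k ^ 2)) →
        hsNorm (K s V kF k) ≤ C * V k * min 1 (kF ^ 2 / latticeNorm k ^ 2) ∧
        ∀ p q : lune kF k,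
          |K s V kF k p q| ≤ C * (V k * kF⁻¹ / (lam k p + lam k q)) ∧
          |(-K s V kF k) p q - s * V k * kF⁻¹ / (2 * (2 * Real.pi) ^ 3)
                * (1 / (lam k p + lam k q))|
              ≤ C * (V k ^ 2 * kF⁻¹ / (lam k p + lam k q)) ∧
          (∀ t ∈ Set.Icc (0 : ℝ) 1,
            |A s V kF k t p q| ≤ C * (1 + V k ^ 2) * V k * kF⁻¹ ∧
            |B s V kF k t p q| ≤ C * (1 + V k ^ 2) * V k * kF⁻¹ ∧
            |anticomm (K s V kF k) (B s V kF k t) p q| ≤ C * (1 + V k ^ 2) * V k ^ 2 * kF⁻¹) ∧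
          IntervalIntegrable (fun t : ℝ => B s V kF k t p q) MeasureTheory.volume 0 1 ∧
          |intB s V kF k p q - s * V k * kF⁻¹ / (4 * (2 * Real.pi) ^ 3)|
              ≤ C * (1 + V k) * V k ^ 2 * kF⁻¹ := by
  have hs' : (0 : ℝ) < s := by exact_mod_cast hs
  obtain ⟨D, hD⟩ : ∃ D : ℝ, D = s / (2 * (2 * Real.pi) ^ 3) := ⟨_, rfl⟩
  have hD0 : 0 < D := by rw [hD]; positivity
  obtain ⟨E, hE⟩ : ∃ E : ℝ, E = D * C₁ := ⟨_, rfl⟩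
  have hE0 : 0 < E := by rw [hE]; positivity
  obtain ⟨G, hG⟩ : ∃ G : ℝ, G = D * (1 + 13 * E + 4 * E ^ 2) := ⟨_, rfl⟩
  have hG0 : 0 < G := by rw [hG]; positivity
  -- The summands are the constants of the separate estimates: E for the Hilbert–Schmidt norm, D and
  -- 3DE for K, G for A, B and the integral of B, 2EG for the anticommutator.
  obtain ⟨C, hC⟩ : ∃ C : ℝ, C = E + D + 3 * D * E + G + 2 * E * G := ⟨_, rfl⟩
  have hDE : 0 < 3 * D * E := by positivity
  have hEG : 0 < 2 * E * G := by positivity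
  have hGC : G ≤ C := by linarith
  have hEC : E ≤ C := by linarith
  have hDC : D ≤ C := by linarith
  have hDEC : 3 * D * E ≤ C := by linarith
  have hEGC : 2 * E * G ≤ C := by linarith
  refine ⟨C, by linarith, fun kF hkF V k hV hsum => ?_⟩
  obtain ⟨μ, hμ⟩ : ∃ μ : ℝ, μ = min 1 (kF ^ 2 / latticeNorm k ^ 2) := ⟨_, rfl⟩
  rw [← hμ] at hsum ⊢
  have hμ1 : μ ≤ 1 := hμ ▸ min_le_left _ _
  have hμ0 : 0 ≤ μ := hμ ▸ le_min zero_le_one (by positivity)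
  obtain ⟨b, hb⟩ : ∃ b : ℝ, b = coupling s V kF k := ⟨_, rfl⟩
  have hb0 : 0 ≤ b := hb ▸ coupling_nonneg hV hkF
  have hbD : b = D * V k * kF⁻¹ := by rw [hb, coupling, hD]; ring
  have hgμ : b * ∑ r : lune kF k, (lam k r)⁻¹ ≤ E * V k * μ := by
    calc _ ≤ b * (C₁ * kF * μ) := mul_le_mul_of_nonneg_left hsum hb0
      _ = D * C₁ * V k * μ * (kF⁻¹ * kF) := by rw [hbD]; ring
      _ = E * V k * μ := by rw [inv_mul_cancel₀ hkF.ne', mul_one, hE]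
  have hgE : b * ∑ r : lune kF k, (lam k r)⁻¹ ≤ E * V k :=
    hgμ.trans (mul_le_of_le_one_right (mul_nonneg hE0.le hV) hμ1)
  have hcoef : s * V k * kF⁻¹ / (2 * (2 * Real.pi) ^ 3) = b := by rw [hb, coupling]
  have hcoef' : s * V k * kF⁻¹ / (4 * (2 * Real.pi) ^ 3) = b / 2 := by rw [hb, coupling]; ring
  rw [hcoef, hcoef']
  have hy := inv_pos.mpr hkF
  constructor
  · have h1 := (operator_bounds (k := k) s hV hkF hb rfl).1
    refine (hsNorm_le_of_entry_le hb0 h1).trans (hgμ.trans ?_)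
    gcongr
  intro p q
  obtain ⟨h1, h2, h3, h4, h5⟩ := entry_estimates hV hkF hD0 hE0 hG hb hbD hgE p q
  have hpq := add_pos (lam_pos p) (lam_pos q)
  refine ⟨h1.trans ?_, h2.trans ?_, fun t ht => ⟨(h3 t ht).1.trans ?_, (h3 t ht).2.1.trans ?_,
    (h3 t ht).2.2.trans ?_⟩, h4, h5.trans ?_⟩ <;> gcongr

end Assembly

/-! ### Lattice points in a cylindrical shell, by volume comparison -/

section ShellCount

open MeasureTheory

theorem volume_annulus_le {α β : ℝ} (hαβ : α ≤ β) :
    volume {y : Fin 2 → ℝ | α ≤ y 0 ^ 2 + y 1 ^ 2 ∧ y 0 ^ 2 + y 1 ^ 2 ≤ β}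
      ≤ ENNReal.ofReal (Real.pi * (β - α)) := by
  rcases lt_or_ge β 0 with hβ | hβ
  · have : {y : Fin 2 → ℝ | α ≤ y 0 ^ 2 + y 1 ^ 2 ∧ y 0 ^ 2 + y 1 ^ 2 ≤ β} = ∅ := by
      ext y
      simp only [Set.mem_ofPred_eq, Set.mem_empty_iff_false, iff_false, not_and, not_le]
      intro _
      nlinarith [sq_nonneg (y 0), sq_nonneg (y 1)]
    rw [this, measure_empty]
    exact zero_le
  set e := (MeasurableEquiv.toLp 2 (Fin 2 → ℝ)) with he
  have hpres : MeasurePreserving e volume volume :=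
    (EuclideanSpace.volume_preserving_symm_measurableEquiv_toLp (Fin 2)).symm
  have hsub : {y : Fin 2 → ℝ | α ≤ y 0 ^ 2 + y 1 ^ 2 ∧ y 0 ^ 2 + y 1 ^ 2 ≤ β}
      ⊆ e ⁻¹' (Metric.closedBall 0 √β \ Metric.ball 0 √α) := by
    rintro y ⟨h1, h2⟩
    have hn : ‖e y‖ = √(y 0 ^ 2 + y 1 ^ 2) := by
      rw [EuclideanSpace.norm_eq, Fin.sum_univ_two, Real.norm_eq_abs, Real.norm_eq_abs, sq_abs,
        sq_abs]
      rfl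
    simp only [Set.mem_preimage, Set.mem_sdiff, mem_closedBall_zero_iff, mem_ball_zero_iff, not_lt]
    rw [hn]
    exact ⟨Real.sqrt_le_sqrt h2, Real.sqrt_le_sqrt h1⟩
  refine (measure_mono hsub).trans ?_
  rw [hpres.measure_preimage_equiv, measure_sdiff
    (Metric.ball_subset_closedBall.trans
      (Metric.closedBall_subset_closedBall (Real.sqrt_le_sqrt hαβ)))
    measurableSet_ball.nullMeasurableSet measure_ball_lt_top.ne, EuclideanSpace.volume_ball_fin_two,
    EuclideanSpace.volume_closedBall_fin_two, ← ENNReal.ofReal_pow (Real.sqrt_nonneg _),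
    ← ENNReal.ofReal_pow (Real.sqrt_nonneg _), ← ENNReal.ofReal_mul (by positivity),
    ← ENNReal.ofReal_mul (by positivity), ← ENNReal.ofReal_sub _ (by positivity)]
  refine ENNReal.ofReal_le_ofReal ?_
  rw [Real.sq_sqrt hβ]
  -- A negative α is allowed: then `√α` is 0, the removed ball is empty, and the bound only gives
  -- away area.
  have h3 : α ≤ √α ^ 2 := by
    rcases le_total 0 α with h | h
    · rw [Real.sq_sqrt h]
    · exact h.trans (sq_nonneg _)
  nlinarith [Real.pi_pos]

theorem volume_cylinder_le {a b α β : ℝ} (hab : a ≤ b) (hαβ : α ≤ β) :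
    volume {y : Fin 3 → ℝ | (a ≤ y 0 ∧ y 0 ≤ b) ∧
        α ≤ y 1 ^ 2 + y 2 ^ 2 ∧ y 1 ^ 2 + y 2 ^ 2 ≤ β}
      ≤ ENNReal.ofReal ((b - a) * (Real.pi * (β - α))) := by
  have hpres := volume_preserving_piFinSuccAbove (fun _ : Fin 3 => ℝ) 0
  have hset : {y : Fin 3 → ℝ | (a ≤ y 0 ∧ y 0 ≤ b) ∧
        α ≤ y 1 ^ 2 + y 2 ^ 2 ∧ y 1 ^ 2 + y 2 ^ 2 ≤ β}
      = MeasurableEquiv.piFinSuccAbove (fun _ : Fin 3 => ℝ) 0 ⁻¹' (Set.Icc a b ×ˢ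
        {y : Fin 2 → ℝ | α ≤ y 0 ^ 2 + y 1 ^ 2 ∧ y 0 ^ 2 + y 1 ^ 2 ≤ β}) := by
    ext y
    rfl
  rw [hset, hpres.measure_preimage_equiv, Measure.volume_eq_prod, Measure.prod_prod,
    Real.volume_Icc, ENNReal.ofReal_mul (sub_nonneg.mpr hab)]
  gcongr
  exact volume_annulus_le hαβ

/-- The volume of a cylindrical shell around a unit vector. -/
theorem volume_cylindrical_shell_le {u : EuclideanSpace ℝ (Fin 3)} (hu : ‖u‖ = 1) {a b α β : ℝ}
    (hab : a ≤ b) (hαβ : α ≤ β) :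
    volume {x : EuclideanSpace ℝ (Fin 3) | (a ≤ inner ℝ u x ∧ inner ℝ u x ≤ b) ∧
        α ≤ ‖x‖ ^ 2 - inner ℝ u x ^ 2 ∧ ‖x‖ ^ 2 - inner ℝ u x ^ 2 ≤ β}
      ≤ ENNReal.ofReal ((b - a) * (Real.pi * (β - α))) := by
  -- Completing u to an orthonormal basis makes it the first coordinate axis without changing
  -- volumes.
  obtain ⟨B, hB⟩ := Orthonormal.exists_orthonormalBasis_extension_of_card_eq (𝕜 := ℝ)
    (E := EuclideanSpace ℝ (Fin 3)) (ι := Fin 3) (by simp) (v := fun _ => u) (s := {0})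
    (by
      refine ⟨fun _ => hu, fun i j hij => ?_⟩
      exact absurd (Subtype.ext (i.2.trans j.2.symm)) hij)
  have hB0 : B 0 = u := hB 0 rfl
  set e := (MeasurableEquiv.toLp 2 (Fin 3 → ℝ)).symm with he
  have hpres : MeasurePreserving (e ∘ B.repr) volume volume :=
    (EuclideanSpace.volume_preserving_symm_measurableEquiv_toLp (Fin 3)).comp
      B.measurePreserving_repr
  set S := {y : Fin 3 → ℝ | (a ≤ y 0 ∧ y 0 ≤ b) ∧
        α ≤ y 1 ^ 2 + y 2 ^ 2 ∧ y 1 ^ 2 + y 2 ^ 2 ≤ β} with hS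
  have hSm : MeasurableSet S := by
    have hcont : Continuous fun y : Fin 3 → ℝ => y 1 ^ 2 + y 2 ^ 2 := by fun_prop
    rw [hS]
    simp only [Set.ofPred_and]
    exact (((isClosed_le continuous_const (continuous_apply 0)).inter
      (isClosed_le (continuous_apply 0) continuous_const)).inter
      ((isClosed_le continuous_const hcont).inter
        (isClosed_le hcont continuous_const))).measurableSet
  have hset : {x : EuclideanSpace ℝ (Fin 3) | (a ≤ inner ℝ u x ∧ inner ℝ u x ≤ b) ∧
        α ≤ ‖x‖ ^ 2 - inner ℝ u x ^ 2 ∧ ‖x‖ ^ 2 - inner ℝ u x ^ 2 ≤ β} = (e ∘ B.repr) ⁻¹' S := by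
    ext x
    have h0 : (e ∘ B.repr) x 0 = inner ℝ u x := by
      rw [← hB0]; exact B.repr_apply_apply x 0
    have h1 : (e ∘ B.repr) x 1 ^ 2 + (e ∘ B.repr) x 2 ^ 2 = ‖x‖ ^ 2 - inner ℝ u x ^ 2 := by
      have h2 : ‖x‖ ^ 2 = ‖B.repr x‖ ^ 2 := by rw [LinearIsometryEquiv.norm_map]
      rw [h2, EuclideanSpace.real_norm_sq_eq, Fin.sum_univ_three, ← h0]
      change (B.repr x) 1 ^ 2 + (B.repr x) 2 ^ 2 = (B.repr x) 0 ^ 2 + (B.repr x) 1 ^ 2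
        + (B.repr x) 2 ^ 2 - (B.repr x) 0 ^ 2
      ring
    simp only [hS, Set.mem_preimage, Set.mem_ofPred_eq, h0, h1]
  rw [hset, hpres.measure_preimage hSm.nullMeasurableSet]
  exact volume_cylinder_le hab hαβ

/-- A lattice point as a vector of Euclidean space. -/
noncomputable def toEuclid (p : Fin 3 → ℤ) : EuclideanSpace ℝ (Fin 3) :=
  WithLp.toLp 2 fun i => (p i : ℝ)

/-- The number of lattice points in a cylindrical shell. -/
theorem card_le_of_mem_shell {u : EuclideanSpace ℝ (Fin 3)} (hu : ‖u‖ = 1)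
    (T : Finset (Fin 3 → ℤ)) {a b α β ρ : ℝ} (hab : a ≤ b) (hαβ : α ≤ β) (hρ : 0 ≤ ρ)
    (hβ : β ≤ ρ ^ 2)
    (hT : ∀ p ∈ T, (a ≤ inner ℝ u (toEuclid p) ∧ inner ℝ u (toEuclid p) ≤ b) ∧
      α ≤ ‖toEuclid p‖ ^ 2 - inner ℝ u (toEuclid p) ^ 2 ∧
      ‖toEuclid p‖ ^ 2 - inner ℝ u (toEuclid p) ^ 2 ≤ β) :
    (T.card : ℝ) ≤ (b - a + 4) * (Real.pi * (β - α + 8 * ρ + 4)) := by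
  -- This shell contains the unit cubes based at the points of T. A cube offset z has norm at most
  -- √3 ≤ 2, so the height changes by at most 2. The squared distance to the axis changes by twice
  -- an inner product bounded by 2ρ, plus a term between 0 and 4.
  set S := {x : EuclideanSpace ℝ (Fin 3) | (a - 2 ≤ inner ℝ u x ∧ inner ℝ u x ≤ b + 2) ∧
        α - 4 * ρ ≤ ‖x‖ ^ 2 - inner ℝ u x ^ 2 ∧ ‖x‖ ^ 2 - inner ℝ u x ^ 2 ≤ β + 4 * ρ + 4} with hS
  set cube : (Fin 3 → ℤ) → Set (EuclideanSpace ℝ (Fin 3)) := fun p =>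
    (MeasurableEquiv.toLp 2 (Fin 3 → ℝ)).symm ⁻¹'
      (Set.univ.pi fun i => Set.Ico (p i : ℝ) (p i + 1)) with hcube
  have hcm : ∀ p : Fin 3 → ℤ, MeasurableSet (Set.univ.pi fun i => Set.Ico (p i : ℝ) (p i + 1)) := fun p =>
    MeasurableSet.univ_pi fun i => measurableSet_Ico
  have hvol : ∀ p, volume (cube p) = 1 := by
    intro p
    rw [hcube, (EuclideanSpace.volume_preserving_symm_measurableEquiv_toLp
      (Fin 3)).measure_preimage_equiv, Real.volume_pi_Ico]
    simp
  have hdisj : (T : Set (Fin 3 → ℤ)).PairwiseDisjoint cube := by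
    intro p _ q _ hpq
    rw [Function.onFun, Set.disjoint_left]
    intro x hxp hxq
    refine hpq (funext fun i => ?_)
    have h1 := hxp i (Set.mem_univ i)
    have h2 := hxq i (Set.mem_univ i)
    have h3 : (p i : ℝ) < (q i : ℝ) + 1 := h1.1.trans_lt h2.2
    have h4 : (q i : ℝ) < (p i : ℝ) + 1 := h2.1.trans_lt h1.2
    have h5 : p i < q i + 1 := by exact_mod_cast h3
    have h6 : q i < p i + 1 := by exact_mod_cast h4
    omega
  have hsub : ⋃ p ∈ T, cube p ⊆ S := by
    intro x hx
    simp only [Set.mem_iUnion] at hx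
    obtain ⟨p, hpT, hxp⟩ := hx
    obtain ⟨⟨ha, hb⟩, hα', hβ'⟩ := hT p hpT
    set y := toEuclid p with hy
    obtain ⟨z, hz⟩ : ∃ z, x = y + z := ⟨x - y, by abel⟩
    have hzn : ‖z‖ ≤ 2 := by
      have h1 : ∀ i, 0 ≤ z i ∧ z i ≤ 1 := by
        intro i
        have h2 := hxp i (Set.mem_univ i)
        have h3 : z i = x i - p i := by
          rw [hz, PiLp.add_apply, hy]
          simp [toEuclid]
        rw [h3]
        have h4 : (p i : ℝ) ≤ x i ∧ x i < p i + 1 := h2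
        constructor <;> linarith [h4.1, h4.2]
      rw [EuclideanSpace.norm_eq, Fin.sum_univ_three]
      simp only [Real.norm_eq_abs, sq_abs]
      refine Real.sqrt_le_iff.mpr ⟨by norm_num, ?_⟩
      nlinarith [h1 0, h1 1, h1 2]
    set w := inner ℝ u y with hw
    set ζ := inner ℝ u z with hζ
    have hux : inner ℝ u x = w + ζ := by rw [hz, inner_add_right]
    have hζn : |ζ| ≤ ‖z‖ := by
      have := abs_real_inner_le_norm u z
      rwa [hu, one_mul] at this
    have hperp : ‖y - w • u‖ ^ 2 = ‖y‖ ^ 2 - w ^ 2 := by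
      rw [norm_sub_sq_real, inner_smul_right, real_inner_comm, norm_smul, hu, Real.norm_eq_abs,
        mul_one, sq_abs]
      ring
    have hpn : ‖y - w • u‖ ≤ ρ := by
      refine abs_le_of_sq_le_sq' ?_ hρ |>.2
      rw [hperp]
      exact hβ'.trans hβ
    have hcross : |inner ℝ y z - w * ζ| ≤ 2 * ρ := by
      have h1 : inner ℝ y z - w * ζ = inner ℝ (y - w • u) z := by
        rw [inner_sub_left, inner_smul_left]; rfl
      rw [h1]
      refine (abs_real_inner_le_norm _ _).trans ?_
      calc _ ≤ ρ * 2 := mul_le_mul hpn hzn (norm_nonneg _) hρ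
        _ = _ := mul_comm _ _
    have hexp : ‖x‖ ^ 2 - inner ℝ u x ^ 2
        = (‖y‖ ^ 2 - w ^ 2) + 2 * (inner ℝ y z - w * ζ) + (‖z‖ ^ 2 - ζ ^ 2) := by
      rw [hux, hz, norm_add_sq_real]
      ring
    have hz2 : 0 ≤ ‖z‖ ^ 2 - ζ ^ 2 := by
      rw [sub_nonneg, ← sq_abs ζ]
      exact pow_le_pow_left₀ (abs_nonneg _) hζn 2
    have hz3 : ‖z‖ ^ 2 - ζ ^ 2 ≤ 4 := by nlinarith [norm_nonneg z, sq_nonneg ζ]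
    have hc := abs_le.mp hcross
    have hζ2 := abs_le.mp (hζn.trans hzn)
    refine ⟨⟨?_, ?_⟩, ?_, ?_⟩
    · rw [hux]; linarith
    · rw [hux]; linarith
    · rw [hexp]; linarith
    · rw [hexp]; linarith
  have hfin := measure_mono (μ := volume) hsub
  rw [measure_biUnion_finset hdisj fun p _ =>
    (MeasurableEquiv.toLp 2 (Fin 3 → ℝ)).symm.measurable (hcm p)] at hfin
  simp only [hvol, Finset.sum_const, nsmul_eq_mul, mul_one] at hfin
  have h1 := hfin.trans (volume_cylindrical_shell_le hu (by linarith) (by linarith))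
  have h2 : (T.card : ENNReal) = ENNReal.ofReal (T.card : ℝ) := by simp
  rw [h2, ENNReal.ofReal_le_ofReal_iff] at h1
  · refine h1.trans (le_of_eq ?_)
    ring
  · refine mul_nonneg (by linarith) (mul_nonneg Real.pi_pos.le (by linarith))

end ShellCount

/-! ### The sum of inverse excitation energies over the lune -/

section LatticeSum

theorem toEuclid_add (p q : Fin 3 → ℤ) : toEuclid (p + q) = toEuclid p + toEuclid q := by
  ext i; simp [toEuclid]

theorem toEuclid_sub (p q : Fin 3 → ℤ) : toEuclid (p - q) = toEuclid p - toEuclid q := by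
  ext i; simp [toEuclid]

theorem toEuclid_nsmul (n : ℕ) (p : Fin 3 → ℤ) : toEuclid (n • p) = (n : ℝ) • toEuclid p := by
  ext i; simp [toEuclid]

theorem latticeNorm_eq_norm (p : Fin 3 → ℤ) : latticeNorm p = ‖toEuclid p‖ := by
  rw [latticeNorm, EuclideanSpace.norm_eq]
  simp [toEuclid]

theorem latticeNorm_sq (p : Fin 3 → ℤ) : latticeNorm p ^ 2 = ∑ i, (p i : ℝ) ^ 2 :=
  Real.sq_sqrt (Finset.sum_nonneg fun _ _ => sq_nonneg _)

theorem one_le_latticeNorm {k : Fin 3 → ℤ} (hk : k ≠ 0) : 1 ≤ latticeNorm k := by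
  obtain ⟨i, hi⟩ := Function.ne_iff.mp hk
  refine le_trans ?_ (abs_coord_le_latticeNorm k i)
  have h1 : 1 ≤ |k i| := Int.one_le_abs hi
  exact_mod_cast h1

theorem lam_eq_inner (k p : Fin 3 → ℤ) :
    lam k p = inner ℝ (toEuclid k) (toEuclid p) - latticeNorm k ^ 2 / 2 := by
  rw [lam, latticeNorm_eq_norm, latticeNorm_eq_norm, latticeNorm_eq_norm, toEuclid_sub,
    norm_sub_sq_real, real_inner_comm]
  ring

/-- Integrality keeps λ at least 1/2, so the dyadic decomposition has a lowest level. -/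
theorem exists_nat_two_mul_lam {kF : ℝ} {k : Fin 3 → ℤ} (p : lune kF k) :
    ∃ m : ℕ, 1 ≤ m ∧ 2 * lam k p = m := by
  have h1 : 2 * lam k p
      = ((∑ i, (p : Fin 3 → ℤ) i ^ 2 - ∑ i, ((p : Fin 3 → ℤ) i - k i) ^ 2 : ℤ) : ℝ) := by
    rw [lam, latticeNorm_sq, latticeNorm_sq]
    push_cast
    simp only [Pi.sub_apply, Int.cast_sub]
    ring
  have h2 := lam_pos p
  set z : ℤ := ∑ i, (p : Fin 3 → ℤ) i ^ 2 - ∑ i, ((p : Fin 3 → ℤ) i - k i) ^ 2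
  have h3 : 0 < z := by
    have : (0 : ℝ) < (z : ℝ) := by rw [← h1]; linarith
    exact_mod_cast this
  refine ⟨z.toNat, by omega, ?_⟩
  rw [h1]
  have : ((z.toNat : ℤ) : ℝ) = (z : ℝ) := by rw [Int.toNat_of_nonneg h3.le]
  exact_mod_cast this.symm

/-- Distinct points of the lune lie on distinct lines in direction `k`. -/
theorem lune_add_nsmul_injOn (kF : ℝ) (k : Fin 3 → ℤ) :
    Set.InjOn (fun x : ℕ × (Fin 3 → ℤ) => x.2 + x.1 • k) {x | x.2 ∈ lune kF k} := by
  -- If p = p' + (j+1)k, then p - k = p' + jk. As ⟨k, p'⟩ > 0 this is no shorter than p', hence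
  -- longer than k_F, which contradicts p being in the lune.
  have key : ∀ (p p' : Fin 3 → ℤ), p ∈ lune kF k → p' ∈ lune kF k → ∀ j : ℕ,
      p ≠ p' + (j + 1) • k := by
    rintro p p' hp hp' j rfl
    have h1 : latticeNorm (p' + (j + 1) • k - k) ^ 2
        = latticeNorm p' ^ 2 + 2 * j * inner ℝ (toEuclid k) (toEuclid p')
          + j ^ 2 * latticeNorm k ^ 2 := by
      have h2 : p' + (j + 1) • k - k = p' + j • k := by rw [succ_nsmul]; abel
      rw [h2, latticeNorm_eq_norm, latticeNorm_eq_norm, latticeNorm_eq_norm, toEuclid_add,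
        toEuclid_nsmul, norm_add_sq_real, inner_smul_right, norm_smul, mul_pow, Real.norm_eq_abs,
        sq_abs, real_inner_comm]
      ring
    have h3 := lam_pos (⟨p', hp'⟩ : lune kF k)
    rw [lam_eq_inner] at h3
    have h4 : 0 ≤ inner ℝ (toEuclid k) (toEuclid p') := by
      have := sq_nonneg (latticeNorm k)
      simp only at h3
      linarith
    have h5 : latticeNorm p' ^ 2 ≤ latticeNorm (p' + (j + 1) • k - k) ^ 2 := by
      rw [h1]
      have : 0 ≤ 2 * (j : ℝ) * inner ℝ (toEuclid k) (toEuclid p') := by positivity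
      have : 0 ≤ (j : ℝ) ^ 2 * latticeNorm k ^ 2 := by positivity
      linarith
    have h6 : latticeNorm p' ≤ latticeNorm (p' + (j + 1) • k - k) :=
      le_of_sq_le_sq h5 (Real.sqrt_nonneg _)
    exact absurd (h6.trans hp.1) (not_le.mpr hp'.2)
  rintro ⟨n, p⟩ hp ⟨n', p'⟩ hp' heq
  simp only [Set.mem_ofPred_eq] at hp hp' heq
  rcases lt_trichotomy n n' with h | h | h
  · obtain ⟨j, rfl⟩ := Nat.exists_eq_add_of_lt h
    refine absurd ?_ (key p p' hp hp' j)
    rw [add_assoc, add_nsmul] at heq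
    refine add_right_cancel (b := n • k) ?_
    rw [heq]; abel
  · subst h
    rw [add_right_cancel heq]
  · obtain ⟨j, rfl⟩ := Nat.exists_eq_add_of_lt h
    refine absurd ?_ (key p' p hp' hp j)
    rw [add_assoc, add_nsmul] at heq
    refine add_right_cancel (b := n' • k) ?_
    rw [← heq]; abel

/-- The number of points of the lune at which `2 λ` is about `M`. -/
theorem card_lune_level_le {R : ℝ} (hR : 1 ≤ R) {k : Fin 3 → ℤ} (hk : k ≠ 0)
    (hkR : latticeNorm k ≤ 4 * R) {M : ℝ} (hM : 1 ≤ M) (hMR : M ≤ 24 * R ^ 2)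
    (S : Finset (Fin 3 → ℤ)) (hS : ∀ p ∈ S, p ∈ lune R k ∧ lam k p ≤ M) :
    (S.card : ℝ) ≤ M * (96 * M / latticeNorm k + 2208 * R / √M) := by
  set a := latticeNorm k with ha
  have ha1 : 1 ≤ a := one_le_latticeNorm hk
  have ha0 : 0 < a := by linarith
  set u := a⁻¹ • toEuclid k with hu
  have hun : ‖u‖ = 1 := by
    rw [hu, norm_smul, ← latticeNorm_eq_norm, ← ha, norm_inv, Real.norm_of_nonneg ha0.le,
      inv_mul_cancel₀ ha0.ne']
  -- The set S lies in a shell of height M/a whose thickness, in squared radius, is 2M + M²/a². For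
  -- short k the term M²/a² is too large. Translating along k keeps the distance to the axis, so
  -- about 1 + M/a² disjoint copies of S fit into the same shell at only twice the height, and
  -- dividing by their number leaves a thickness of order M.
  set n₀ : ℕ := ⌊M / a ^ 2⌋₊ + 1 with hn₀
  set T : Finset (Fin 3 → ℤ) := (Finset.range n₀ ×ˢ S).image fun x => x.2 + x.1 • k with hT
  have hcard : T.card = n₀ * S.card := by
    rw [hT, Finset.card_image_of_injOn, Finset.card_product, Finset.card_range]
    refine (lune_add_nsmul_injOn R k).mono ?_
    intro x hx
    exact (hS x.2 (Finset.mem_product.mp hx).2).1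
  set D := R ^ 2 - a ^ 2 / 4 with hD
  -- The radius 5R is admissible because D + M ≤ R² + 24R².
  have hbound := card_le_of_mem_shell hun T (a := a / 2) (b := a / 2 + 2 * (M / a))
    (α := D - M - M ^ 2 / a ^ 2) (β := D + M) (ρ := 5 * R)
    (by have : 0 ≤ M / a := by positivity
        linarith)
    (by have : 0 ≤ M ^ 2 / a ^ 2 := by positivity
        linarith)
    (by linarith) (by nlinarith) (by
      intro y hy
      rw [hT, Finset.mem_image] at hy
      obtain ⟨⟨n, p⟩, hnp, rfl⟩ := hy
      obtain ⟨hn, hp⟩ := Finset.mem_product.mp hnp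
      obtain ⟨hpl, hpM⟩ := hS p hp
      have hpos := lam_pos (⟨p, hpl⟩ : lune R k)
      simp only at hpos hn
      have hn1 : (n : ℝ) ≤ M / a ^ 2 := by
        have h1 : n ≤ ⌊M / a ^ 2⌋₊ := by
          rw [Finset.mem_range, hn₀] at hn; omega
        exact (Nat.le_floor_iff (by positivity)).mp h1
      set l := lam k p with hl
      dsimp only
      have hkp : inner ℝ (toEuclid k) (toEuclid p) = l + a ^ 2 / 2 := by
        rw [hl, lam_eq_inner]; ring
      have hkk : inner ℝ (toEuclid k) (toEuclid k) = a ^ 2 := by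
        rw [real_inner_self_eq_norm_sq, ← latticeNorm_eq_norm]
      have hw : inner ℝ u (toEuclid (p + n • k)) = l / a + a / 2 + n * a := by
        rw [toEuclid_add, toEuclid_nsmul, inner_add_right, inner_smul_right, hu, inner_smul_left,
          inner_smul_left, hkp, hkk]
        simp only [conj_trivial]
        field_simp
      have hn2 : ‖toEuclid (p + n • k)‖ ^ 2
          = latticeNorm p ^ 2 + 2 * n * (l + a ^ 2 / 2) + n ^ 2 * a ^ 2 := by
        rw [toEuclid_add, toEuclid_nsmul, norm_add_sq_real, inner_smul_right, real_inner_comm, hkp,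
          norm_smul, mul_pow, ← latticeNorm_eq_norm, ← latticeNorm_eq_norm, Real.norm_eq_abs,
          sq_abs]
        ring
      have hperp : ‖toEuclid (p + n • k)‖ ^ 2 - inner ℝ u (toEuclid (p + n • k)) ^ 2
          = latticeNorm p ^ 2 - l ^ 2 / a ^ 2 - l - a ^ 2 / 4 := by
        rw [hn2, hw]
        field_simp
        ring
      have hp1 : R ^ 2 ≤ latticeNorm p ^ 2 := by
        have := hpl.2.le
        gcongr
      have hp2 : latticeNorm p ^ 2 ≤ R ^ 2 + 2 * l := by
        have h1 : latticeNorm (p - k) ^ 2 ≤ R ^ 2 := by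
          have := hpl.1
          have h0 : 0 ≤ latticeNorm (p - k) := Real.sqrt_nonneg _
          gcongr
        have h2 : latticeNorm p ^ 2 = latticeNorm (p - k) ^ 2 + 2 * l := by rw [hl, lam]; ring
        linarith
      have hl2 : l ^ 2 / a ^ 2 ≤ M ^ 2 / a ^ 2 := by gcongr
      have hl3 : 0 ≤ l ^ 2 / a ^ 2 := by positivity
      rw [hperp, hw]
      have hla : l / a ≤ M / a := by gcongr
      have hla0 : 0 ≤ l / a := by positivity
      have hna : n * a ≤ M / a := by
        calc n * a ≤ M / a ^ 2 * a := by gcongr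
          _ = M / a := by field_simp
      have hna0 : 0 ≤ n * a := by positivity
      refine ⟨⟨by linarith, by linarith⟩, by linarith, by linarith⟩)
  rw [hcard] at hbound
  push_cast at hbound
  set N : ℝ := (S.card : ℝ) with hN
  have hN0 : 0 ≤ N := Nat.cast_nonneg _
  set x := M / a ^ 2 with hx
  have hx0 : 0 < x := by positivity
  have hnx : 1 + x ≤ 2 * n₀ := by
    have h1 : x < n₀ := by
      rw [hn₀]; push_cast; exact Nat.lt_floor_add_one x
    have h2 : (1 : ℝ) ≤ n₀ := by rw [hn₀]; push_cast; linarith [Nat.cast_nonneg (α := ℝ) ⌊x⌋₊]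
    linarith
  have hMx : M ^ 2 / a ^ 2 = M * x := by rw [hx]; ring
  rw [hMx] at hbound
  set y := M / a with hy
  have hy0 : 0 < y := by positivity
  have hmain : N * (1 + x) ≤ 16 * (y + 2) * (2 * M * (1 + x) + 44 * R) := by
    have h1 : N * (1 + x) ≤ 2 * (n₀ * N) := by nlinarith
    have h2 : (a / 2 + 2 * y - a / 2 + 4) * (Real.pi * (D + M - (D - M - M * x) + 8 * (5 * R) + 4))
        ≤ (2 * y + 4) * (4 * (2 * M * (1 + x) + 44 * R)) := by
      have h3 : a / 2 + 2 * y - a / 2 + 4 = 2 * y + 4 := by ring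
      rw [h3]
      have h4 : 0 ≤ M * x := by positivity
      refine mul_le_mul_of_nonneg_left ?_ (by positivity)
      refine mul_le_mul Real.pi_le_four (by linarith) (by linarith) (by norm_num)
    linarith
  set r := √M with hr
  have hr2 : r ^ 2 = M := Real.sq_sqrt (by linarith)
  have hr1 : 1 ≤ r := Real.one_le_sqrt.mpr hM
  -- The arithmetic–geometric mean inequality for 1 and r/a, whose product is y/r and whose squares
  -- sum to 1 + x. It bounds the surface error R·y after division by 1 + x.
  have hxy : y ≤ r / 2 * (1 + x) := by
    have e1 : r / 2 * (1 + x) - y = r / 2 * (1 - r / a) ^ 2 := by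
      rw [hx, hy, ← hr2]
      field_simp
      ring
    have e2 : 0 ≤ r / 2 * (1 - r / a) ^ 2 := by positivity
    linarith
  have hN1 : N ≤ 32 * M * (y + 2) + 704 * R * (r / 2 + 2) := by
    have h1 : (1 + x) * N ≤ (1 + x) * (32 * M * (y + 2) + 704 * R * (r / 2 + 2)) := by
      have e1 : 704 * R * (y + 2) ≤ 704 * R * (r / 2 * (1 + x) + 2 * (1 + x)) := by
        refine mul_le_mul_of_nonneg_left ?_ (by linarith)
        linarith
      nlinarith
    exact le_of_mul_le_mul_left h1 (by linarith)
  -- This absorbs the lower-order term of size M; for a > M it uses M < a ≤ 4R ≤ 4R².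
  have hone : 1 ≤ y + 2 * R / r := by
    rcases le_total a M with h | h
    · have e1 : 1 ≤ y := by rw [hy, le_div_iff₀ ha0]; linarith
      have e2 : 0 ≤ 2 * R / r := by positivity
      linarith
    · have e1 : r ≤ 2 * R := by
        refine Real.sqrt_le_iff.mpr ⟨by linarith, ?_⟩
        nlinarith
      have e2 : 1 ≤ 2 * R / r := by rw [le_div_iff₀ (by linarith)]; linarith
      linarith
  have e1 : M * (2 * R / r) = 2 * R * r := by
    rw [← hr2]; field_simp
  have e2 : M * (96 * M / a + 2208 * R / r) = 96 * M * y + 2208 * R * r := by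
    rw [mul_add, hy, ← hr2]; field_simp
  rw [e2]
  have e3 : M ≤ M * y + 2 * R * r := by
    rw [← e1, ← mul_add]
    exact le_mul_of_one_le_right (by linarith) hone
  have e4 : R ≤ R * r := le_mul_of_one_le_right (by linarith) hr1
  nlinarith

/-- The level 2λ ~ 2^j contributes a multiple of 2^j/a + R 2^{-j/2}. The first part is dominated by
the top level, where 2^J ≤ 6Ra, the second by the bottom one; both give a multiple of R. -/
theorem sum_inv_lam_le_of_le {R : ℝ} (hR : 1 ≤ R) {k : Fin 3 → ℤ} (hk : k ≠ 0)
    (hkR : latticeNorm k ≤ 4 * R) : ∑ r : lune R k, (lam k r)⁻¹ ≤ 20000 * R := by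
  set a := latticeNorm k with ha
  have ha1 : 1 ≤ a := one_le_latticeNorm hk
  choose m hm1 hm using fun p : lune R k => exists_nat_two_mul_lam p
  have hmle : ∀ p, (m p : ℝ) ≤ 6 * R * a := by
    intro p
    rw [← hm p, lam]
    have h1 := p.2.1
    have h0 : 0 ≤ latticeNorm ((p : Fin 3 → ℤ) - k) := Real.sqrt_nonneg _
    have h2 : latticeNorm p ≤ latticeNorm ((p : Fin 3 → ℤ) - k) + a := by
      rw [ha, latticeNorm_eq_norm, latticeNorm_eq_norm, latticeNorm_eq_norm, toEuclid_sub]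
      exact norm_le_norm_sub_add _ _
    have h3 : 0 ≤ latticeNorm p := Real.sqrt_nonneg _
    nlinarith
  set J := Nat.log 2 ⌊6 * R * a⌋₊ with hJ
  have hfl : 1 ≤ ⌊6 * R * a⌋₊ := by
    refine Nat.le_floor ?_
    push_cast
    nlinarith
  have hJ2 : (2 : ℝ) ^ J ≤ 6 * R * a := by
    have h1 : 2 ^ J ≤ ⌊6 * R * a⌋₊ := Nat.pow_log_le_self 2 (by omega)
    have h2 : ((2 ^ J : ℕ) : ℝ) ≤ 6 * R * a := (Nat.le_floor_iff (by positivity)).mp h1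
    exact_mod_cast h2
  have hmaps : ∀ p ∈ (Finset.univ : Finset (lune R k)),
      Nat.log 2 (m p) ∈ Finset.range (J + 1) := by
    intro p _
    rw [Finset.mem_range, Nat.lt_succ_iff]
    exact Nat.log_mono_right (Nat.le_floor (hmle p))
  rw [← Finset.sum_fiberwise_of_maps_to hmaps]
  have hlevel : ∀ j ∈ Finset.range (J + 1),
      ∑ p : lune R k with Nat.log 2 (m p) = j, (lam k p)⁻¹
        ≤ 192 / a * 2 ^ j + 4416 * R * (√2)⁻¹ ^ j := by
    intro j hj
    have hjJ : (2 : ℝ) ^ j ≤ 2 ^ J :=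
      pow_le_pow_right₀ (by norm_num) (Nat.lt_succ_iff.mp (Finset.mem_range.mp hj))
    have hj0 : (0 : ℝ) < 2 ^ j := by positivity
    have h1 : ∀ p ∈ Finset.univ.filter (fun p : lune R k => Nat.log 2 (m p) = j),
        (lam k p)⁻¹ ≤ 2 / 2 ^ j := by
      intro p hp
      have h2 : 2 ^ j ≤ m p := by
        rw [← (Finset.mem_filter.mp hp).2]
        exact Nat.pow_log_le_self 2 (by have := hm1 p; omega)
      have h3 : (2 : ℝ) ^ j ≤ m p := by exact_mod_cast h2
      rw [← hm p] at h3
      rw [inv_le_comm₀ (lam_pos p) (by positivity), inv_div]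
      linarith
    -- On this level 2^j ≤ 2λ < 2^{j+1}, so M = 2^j bounds λ itself; M ≤ 24R² follows from 6Ra ≤
    -- 24R².
    have hcard := card_lune_level_le hR hk hkR (M := 2 ^ j) (one_le_pow₀ (by norm_num))
      (by nlinarith) ((Finset.univ.filter (fun p : lune R k => Nat.log 2 (m p) = j)).map
        (Function.Embedding.subtype _)) (by
        intro p hp
        obtain ⟨p', hp', rfl⟩ := Finset.mem_map.mp hp
        refine ⟨p'.2, ?_⟩
        have h2 : m p' < 2 ^ (j + 1) := by
          rw [← (Finset.mem_filter.mp hp').2]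
          exact Nat.lt_pow_succ_log_self (by norm_num) _
        have h3 : (m p' : ℝ) < 2 ^ (j + 1) := by exact_mod_cast h2
        rw [← hm p', pow_succ] at h3
        change lam k p' ≤ 2 ^ j
        linarith)
    rw [Finset.card_map] at hcard
    refine (Finset.sum_le_card_nsmul _ _ _ h1).trans ?_
    rw [nsmul_eq_mul]
    have hsq : √((2 : ℝ) ^ j) = √2 ^ j := by
      rw [Real.sqrt_eq_iff_mul_self_eq (by positivity) (by positivity), ← mul_pow,
        Real.mul_self_sqrt (by norm_num)]
    calc _ ≤ 2 ^ j * (96 * 2 ^ j / a + 2208 * R / √(2 ^ j)) * (2 / 2 ^ j) :=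
          mul_le_mul_of_nonneg_right hcard (by positivity)
      _ = 192 / a * 2 ^ j + 4416 * R * (√2)⁻¹ ^ j := by
          rw [hsq, inv_pow]; field_simp; ring
  refine (Finset.sum_le_sum hlevel).trans ?_
  rw [Finset.sum_add_distrib, ← Finset.mul_sum, ← Finset.mul_sum]
  have hg1 : ∑ j ∈ Finset.range (J + 1), (2 : ℝ) ^ j ≤ 2 * (6 * R * a) := by
    rw [geom_sum_eq (by norm_num), pow_succ]
    linarith
  have hg2 : ∑ j ∈ Finset.range (J + 1), (√2)⁻¹ ^ j ≤ 4 := by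
    have h1 : (√2 : ℝ)⁻¹ ≤ 3 / 4 := by
      rw [inv_le_comm₀ (by positivity) (by norm_num)]
      exact Real.le_sqrt_of_sq_le (by norm_num)
    calc ∑ j ∈ Finset.range (J + 1), (√2)⁻¹ ^ j
        ≤ ∑ j ∈ Finset.range (J + 1), (3 / 4 : ℝ) ^ j :=
          Finset.sum_le_sum fun j _ => pow_le_pow_left₀ (by positivity) h1 j
      _ = (1 - (3 / 4 : ℝ) ^ (J + 1)) * 4 := by rw [geom_sum_eq (by norm_num)]; ring
      _ ≤ 4 := by have : (0 : ℝ) ≤ (3 / 4 : ℝ) ^ (J + 1) := by positivity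
                  linarith
  have e1 : 192 / a * ∑ j ∈ Finset.range (J + 1), (2 : ℝ) ^ j ≤ 2304 * R := by
    calc _ ≤ 192 / a * (2 * (6 * R * a)) := by gcongr
      _ = 2304 * R := by field_simp; ring
  have e2 : 4416 * R * ∑ j ∈ Finset.range (J + 1), (√2)⁻¹ ^ j ≤ 4416 * R * 4 := by gcongr
  linarith

theorem sum_inv_lam_le_of_lt {R : ℝ} (hR : 1 ≤ R) {k : Fin 3 → ℤ}
    (hkR : 4 * R < latticeNorm k) :
    ∑ r : lune R k, (lam k r)⁻¹ ≤ 20000 * R * (R ^ 2 / latticeNorm k ^ 2) := by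
  set a := latticeNorm k with ha
  have ha0 : 0 < a := by linarith
  set u := a⁻¹ • toEuclid k with hu
  have hun : ‖u‖ = 1 := by
    rw [hu, norm_smul, ← latticeNorm_eq_norm, ← ha, norm_inv, Real.norm_of_nonneg ha0.le,
      inv_mul_cancel₀ ha0.ne']
  set T : Finset (Fin 3 → ℤ) := Finset.univ.image fun p : lune R k => (p : Fin 3 → ℤ) - k with hT
  have hcard : T.card = Fintype.card (lune R k) := by
    rw [hT, Finset.card_image_of_injective, Finset.card_univ]
    intro p q hpq
    exact Subtype.ext (sub_left_injective hpq)
  have hb := card_le_of_mem_shell hun T (a := -R) (b := R) (α := 0) (β := R ^ 2) (ρ := R)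
    (by linarith) (sq_nonneg R) (by linarith) le_rfl (by
      intro q hq
      obtain ⟨p, -, rfl⟩ := Finset.mem_image.mp hq
      have h1 := p.2.1
      rw [latticeNorm_eq_norm] at h1
      have h2 := abs_real_inner_le_norm u (toEuclid ((p : Fin 3 → ℤ) - k))
      rw [hun, one_mul] at h2
      have h3 := abs_le.mp (h2.trans h1)
      have h4 := pow_le_pow_left₀ (abs_nonneg _) h2 2
      rw [sq_abs] at h4
      have h5 := pow_le_pow_left₀ (norm_nonneg _) h1 2
      exact ⟨h3, by linarith, by linarith [sq_nonneg (inner ℝ u (toEuclid ((p : Fin 3 → ℤ) - k)))]⟩)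
  rw [hcard] at hb
  have hb' : (Fintype.card (lune R k) : ℝ) ≤ 312 * R ^ 3 := by
    refine hb.trans ?_
    calc (R - -R + 4) * (Real.pi * (R ^ 2 - 0 + 8 * R + 4))
        ≤ (6 * R) * (4 * (13 * R ^ 2)) := by
          refine mul_le_mul (by linarith) ?_ (mul_nonneg Real.pi_pos.le (by nlinarith)) (by positivity)
          refine mul_le_mul Real.pi_le_four (by nlinarith) (by nlinarith) (by norm_num)
      _ = 312 * R ^ 3 := by ring
  -- With r = |p - k| ≤ R < a/4, 2λ ≥ (a - r)² - r² = a² - 2ar ≥ a²/2.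
  have hterm : ∀ p ∈ (Finset.univ : Finset (lune R k)), (lam k p)⁻¹ ≤ 4 / a ^ 2 := by
    intro p _
    rw [inv_le_comm₀ (lam_pos p) (by positivity), inv_div, lam]
    have h1 := p.2.1
    have h0 : 0 ≤ latticeNorm ((p : Fin 3 → ℤ) - k) := Real.sqrt_nonneg _
    have h2 : a ≤ latticeNorm p + latticeNorm ((p : Fin 3 → ℤ) - k) := by
      rw [ha, latticeNorm_eq_norm, latticeNorm_eq_norm, latticeNorm_eq_norm, toEuclid_sub]
      have := norm_sub_le (toEuclid (p : Fin 3 → ℤ)) (toEuclid p - toEuclid k)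
      rwa [sub_sub_cancel] at this
    have h3 : (a - latticeNorm ((p : Fin 3 → ℤ) - k)) ^ 2 ≤ latticeNorm p ^ 2 :=
      pow_le_pow_left₀ (by linarith) (by linarith) 2
    nlinarith
  refine (Finset.sum_le_card_nsmul _ _ _ hterm).trans ?_
  rw [nsmul_eq_mul, Finset.card_univ]
  calc (Fintype.card (lune R k) : ℝ) * (4 / a ^ 2) ≤ 312 * R ^ 3 * (4 / a ^ 2) := by gcongr
    _ = 1248 * (R * (R ^ 2 / a ^ 2)) := by ring
    _ ≤ 20000 * (R * (R ^ 2 / a ^ 2)) := by gcongr; norm_num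
    _ = _ := by ring

/-- `∑ λ⁻¹ ≤ C k_F min {1, k_F² |k|⁻²}`. -/
theorem sum_inv_lam_le {R : ℝ} (hR : 1 ≤ R) {k : Fin 3 → ℤ} (hk : k ≠ 0) :
    ∑ r : lune R k, (lam k r)⁻¹ ≤ 320000 * R * min 1 (R ^ 2 / latticeNorm k ^ 2) := by
  have ha0 : 0 < latticeNorm k := by linarith [one_le_latticeNorm hk]
  rcases le_or_gt (latticeNorm k) (4 * R) with h | h
  -- For |k| ≤ 4R the minimum is bounded below, which costs the factor 16 in 320000 = 16 · 20000.
  · have h1 : 1 / 16 ≤ min 1 (R ^ 2 / latticeNorm k ^ 2) := by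
      refine le_min (by norm_num) ?_
      rw [le_div_iff₀ (by positivity)]
      nlinarith
    refine (sum_inv_lam_le_of_le hR hk h).trans ?_
    nlinarith
  · have h1 : R ^ 2 / latticeNorm k ^ 2 ≤ 1 := by
      rw [div_le_one (by positivity)]
      gcongr
      linarith
    rw [min_eq_right h1]
    refine (sum_inv_lam_le_of_lt hR h).trans ?_
    have : 0 ≤ R ^ 2 / latticeNorm k ^ 2 := by positivity
    gcongr
    norm_num

end LatticeSum
end FermiGas

theorem mainTheorem6 (s : ℕ) (hs : 1 ≤ s) :
    (∀ (V : (Fin 3 → ℤ) → ℝ), (∀ k, k ≠ 0 → V (-k) = V k) → (∀ k, k ≠ 0 → 0 ≤ V k) →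
      ∀ kF : ℝ, 0 < kF → ∀ k : Fin 3 → ℤ, k ≠ 0 →
        MeasureTheory.IntegrableOn
          (fun t : ℝ => FermiGas.F (FermiGas.bosonicArg s V kF k t)) (Set.Ioi 0) ∧
        Matrix.trace
            (FermiGas.expK s V kF k (-1) * FermiGas.h kF k * FermiGas.expK s V kF k (-1)
              - FermiGas.h kF k - FermiGas.P s V kF k)
          = 1 / Real.pi *
            ∫ t in Set.Ioi (0 : ℝ), FermiGas.F (FermiGas.bosonicArg s V kF k t)) ∧
    (∃ C : ℝ, 0 < C ∧ ∃ κ : ℝ, 0 < κ ∧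
      ∀ kF : ℝ, κ ≤ kF →
      ∀ (V : (Fin 3 → ℤ) → ℝ), (∀ k, k ≠ 0 → V (-k) = V k) → (∀ k, k ≠ 0 → 0 ≤ V k) →
      ∀ k : Fin 3 → ℤ, k ≠ 0 →
        FermiGas.hsNorm (FermiGas.K s V kF k)
          ≤ C * V k * min 1 (kF ^ 2 / FermiGas.latticeNorm k ^ 2) ∧
        ∀ p q : FermiGas.lune kF k,
          |FermiGas.K s V kF k p q|
              ≤ C * (V k * kF⁻¹ / (FermiGas.lam k p + FermiGas.lam k q)) ∧
          |(-FermiGas.K s V kF k) p q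
              - s * V k * kF⁻¹ / (2 * (2 * Real.pi) ^ 3)
                * (1 / (FermiGas.lam k p + FermiGas.lam k q))|
              ≤ C * (V k ^ 2 * kF⁻¹ / (FermiGas.lam k p + FermiGas.lam k q)) ∧
          (∀ t ∈ Set.Icc (0 : ℝ) 1,
            |FermiGas.A s V kF k t p q| ≤ C * (1 + V k ^ 2) * V k * kF⁻¹ ∧
            |FermiGas.B s V kF k t p q| ≤ C * (1 + V k ^ 2) * V k * kF⁻¹ ∧
            |FermiGas.anticomm (FermiGas.K s V kF k) (FermiGas.B s V kF k t) p q|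
              ≤ C * (1 + V k ^ 2) * V k ^ 2 * kF⁻¹) ∧
          IntervalIntegrable (fun t : ℝ => FermiGas.B s V kF k t p q)
            MeasureTheory.volume 0 1 ∧
          |FermiGas.intB s V kF k p q - s * V k * kF⁻¹ / (4 * (2 * Real.pi) ^ 3)|
              ≤ C * (1 + V k) * V k ^ 2 * kF⁻¹) := by
  constructor
  · intro V _ hV kF hkF k hk
    exact FermiGas.trace_formula s (hV k hk) hkF
  · obtain ⟨C, hC, hest⟩ := FermiGas.estimates_of_sum_bound (s := s) (C₁ := 320000) (by norm_num) hs
    -- The threshold κ = 1 is exactly what the lattice sum bound requires.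
    refine ⟨C, hC, 1, one_pos, fun kF hkF V _ hV k hk => ?_⟩
    exact hest kF (by linarith) V k (hV k hk) (FermiGas.sum_inv_lam_le hkF hk)
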